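/- **Setting.** Let $\mathcal T$ be a finite simplicial complex in $\mathbb R^n$ in which every simplex is contained in an $n$-simplex, let $\mathcal U\subseteq\mathcal T$ be a subcomplex, and let every simplex of $\mathcal T$ be oriented. $\mathcal T^m$, $\mathcal U^m$ denote the sets of $m$-simplices; $F\trianglelefteq C$ means that $F$ is a subsimplex of $C$ (and $F\triangleleft C$ that moreover $F\ne C$); $o(F,C)=\pm1$ is the incidence number of a facet $F$ of $C$. $\mathcal C_m(\mathcal K,\mathcal L)$ is the real vector space with basis $\mathcal K^m\setminus\mathcal L^m$, with boundary $\partial_m C=\sum_{F\triangleleft C,\,F\in\mathcal K^{m-1}\setminus\mathcal L^{m-1}}o(F,C)F$, and $\mathcal H_m(\mathcal K,\mathcal L)=\ker\partial_m/\operatorname{ran}\partial_{m+1}$. On every $C\in\mathcal T$ let finite-dimensional spaces $\Lambda^k(C)$ of smooth differential $k$-forms on $C$ (pullbacks to $C$ of smooth forms on $\mathbb R^n$) be given with $d\Lambda^k(C)\subseteq\Lambda^{k+1}(C)$ and $\operatorname{tr}_{C,F}\Lambda^k(C)=\Lambda^k(F)$ for $F\trianglelefteq C$, where $\operatorname{tr}_{C,F}$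 is the pullback from $C$ to $F$. Let $\mathring\Lambda^k(F)=\{\omega\in\Lambda^k(F):\operatorname{tr}_{F,G}\omega=0\text{ for all }G\triangleleft F\}$. Assume: * *Local exactness*: for every $C\in\mathcal T\setminus\mathcal U$, the kernel of $d$ on $\Lambda^0(C)$ is spanned by the indicator function $1_C$, and every $\omega\in\Lambda^{k+1}(C)$ with $d\omega=0$ lies in $d\Lambda^{k}(C)$ ($k\ge0$). * *Geometric decomposition*: there are linear maps $\operatorname{ext}_{F,C}^k:\mathring\Lambda^k(F)\to\Lambda^k(C)$ for $F\trianglelefteq C$ in $\mathcal T$ with $\operatorname{tr}_{C,F}\operatorname{ext}^k_{F,C}=\mathrm{Id}$, $\operatorname{tr}_{C,G}\operatorname{ext}^k_{F,C}=\operatorname{ext}^k_{F,G}$ if $F\trianglelefteq G\trianglelefteq C$, and $\operatorname{tr}_{C,G}\operatorname{ext}^k_{F,C}=0$ if $G\trianglelefteq C$ and $F\not\trianglelefteq G$. * *Local patch condition*: for all $F\in\mathcal T$ and $0\le m<n$ we have $\mathcal H_m(\mathcal M_F,\mathcal N_F)=0$, where $\mathcal M_F=\{G\in\mathcal T:\exists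 C\in\mathcal T^n,\ F\trianglelefteq C,\ G\trianglelefteq C\}$ and $\mathcal N_F=\{G\in\mathcal M_F:\dim G\le n-1,\ F\not\trianglelefteq G\text{ or }G\in\mathcal U\}$. Put $\Lambda_{-1}^k(\mathcal T^m)=\bigoplus_{C\in\mathcal T^m\setminus\mathcal U^m}\Lambda^k(C)$, each with a fixed, arbitrary scalar product; spaces with $k<0$, $m<0$ or $m>n$ are zero. Let $\mathsf D:\Lambda_{-1}^k(\mathcal T^m)\to\Lambda_{-1}^{k+1}(\mathcal T^m)$ be the simplexwise exterior derivative, and let $\mathsf T:\Lambda_{-1}^k(\mathcal T^m)\to\Lambda_{-1}^k(\mathcal T^{m-1})$ be given by $(\mathsf T\omega)_F=\sum_{C\triangleright F}o(F,C)\operatorname{tr}_{C,F}\omega_C$. For $b\ge1$ let $$\Lambda^k_{-b}(\mathcal T^m)=\bigoplus_{j=0}^{b-1}\Lambda_{-1}^{k-j}(\mathcal T^{m-j}),\qquad \Gamma^k_{-b}(\mathcal T^m)=\bigoplus_{j=0}^{b-1}\Lambda_{-1}^{k+j}(\mathcal T^{m+j})$$ be orthogonal direct sums, regarded as subspaces of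 the orthogonal direct sum of all $\Lambda^k_{-1}(\mathcal T^m)$, and let $\Lambda^k_0(\mathcal T^m)=\ker\mathsf T\cap\Lambda_{-1}^k(\mathcal T^m)$ and $\Gamma^k_0(\mathcal T^m)=\ker\mathsf D\cap\Lambda_{-1}^k(\mathcal T^m)$. The distributional exterior derivative is $\mathbf d\omega=(-1)^i(\mathsf D\omega-\mathsf T\omega)$ for $\omega\in\Lambda_{-1}^{k}(\mathcal T^{n-i})$. Define the harmonic spaces $$\mathfrak H^k(\mathcal T^n)=\{\omega\in\Lambda^k_0(\mathcal T^n):\mathsf D\omega=0,\ \omega\perp\mathsf D\Lambda_0^{k-1}(\mathcal T^n)\},\qquad \mathfrak C^0(\mathcal T^m)=\{\omega\in\Gamma^0_0(\mathcal T^m):\mathsf T\omega=0,\ \omega\perp\mathsf T\Gamma_0^{0}(\mathcal T^{m+1})\},$$ and for $b\ge1$ $$\mathfrak H^k_{-b}(\mathcal T^n)=\{\omega\in\Lambda^k_{-b}(\mathcal T^n):\mathbf d\omega=0,\ \omega\perp\mathbf d\Lambda^{k-1}_{-b+1}(\mathcal T^n)\},\qquad \mathfrak C^0_{-b}(\mathcal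 T^m)=\{\omega\in\Gamma^0_{-b}(\mathcal T^m):\mathbf d\omega=0,\ \omega\perp\mathbf d\Gamma^{0}_{-b+1}(\mathcal T^{m+1})\}.$$ Let $\mathsf E_k^m:\Lambda_{-1}^k(\mathcal T^{m-1})\to\Lambda_{-1}^k(\mathcal T^m)$ and $\mathsf P_k^m:\Lambda_{-1}^{k+1}(\mathcal T^m)\to\Lambda_{-1}^k(\mathcal T^m)$ be any linear operators with $\mathsf T\mathsf E\mathsf T=\mathsf T$ and $\mathsf D\mathsf P\mathsf D=\mathsf D$. For $2\le b\le k+1$ define $R_{k,b}$ on $\Lambda_{-b}^k(\mathcal T^n)$ by $R_{k,b}\omega=\omega-(-1)^{b+1}\mathbf d\,\mathsf E_{k-b+1}^{n-b+2}\omega$, and for $2\le b\le n-m+1$ define $S_{m,b}$ on $\Gamma^0_{-b}(\mathcal T^m)$ by $S_{m,b}\omega=\omega+(-1)^{b+n-m}\mathbf d\,\mathsf P_{b-2}^{m+b-1}\omega$, where $\mathsf E_{k-b+1}^{n-b+2}$ and $\mathsf P_{b-2}^{m+b-1}$ act on the component of $\omega$ in $\Lambda_{-1}^{k-b+1}(\mathcal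 T^{n-b+1})$ and in $\Lambda_{-1}^{b-1}(\mathcal T^{m+b-1})$, respectively. Let $R_{k,b}^*$, $S_{m,b}^*$ be the adjoints on $\Lambda_{-b}^k(\mathcal T^n)$ and $\Gamma^0_{-b}(\mathcal T^m)$, and let $Q$ be the orthogonal projection of the respective space onto the kernel of $\mathbf d$ in it. **Theorem.** For $0\le k\le n$ we have $$\mathcal H_{n-k}(\mathcal T,\mathcal U)\simeq\mathfrak C^0(\mathcal T^{n-k})=\mathfrak C^0_{-1}(\mathcal T^{n-k})\simeq\dots\simeq\mathfrak C^0_{-k-1}(\mathcal T^{n-k})=\mathfrak H^k_{-k-1}(\mathcal T^n)\simeq\dots\simeq\mathfrak H^k_{-1}(\mathcal T^n)=\mathfrak H^k(\mathcal T^n).$$ Here the first isomorphism is the one induced by identifying each simplex $C$ with $1_C$: each $\omega\in\mathfrak C^0(\mathcal T^{n-k})$ is of the form $\sum c_C1_C$ for a relative cycle $\sum c_C C$, whose homology class is mapped to $\omega$. For $2\le b\le k+1$, the operator $Q\,S_{n-k,b}^*$ restricts to an isomorphism $\mathfrak C^0_{-b+1}(\mathcal T^{n-k})\to\mathfrak C^0_{-b}(\mathcal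 T^{n-k})$, and $Q\,R_{k,b}^*$ restricts to an isomorphism $\mathfrak H^k_{-b+1}(\mathcal T^n)\to\mathfrak H^k_{-b}(\mathcal T^n)$. -/

import Mathlib

noncomputable section

namespace FEDist

/-- The ambient Euclidean space `ℝⁿ`. -/
abbrev Eucl (n : ℕ) := EuclideanSpace ℝ (Fin n)

/-! ### Smooth differential forms on a simplex

A simplex is given by the finite set `s` of its vertices; the closed simplex is `convexHull ℝ s`,
its tangent space at every point is the direction `vectorSpan ℝ s` of its affine hull. -/

/-- The tangent space of the simplex with vertex set `s`. -/
abbrev Dir {n : ℕ} (s : Finset (Eucl n)) : Submodule ℝ (Eucl n) :=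
  vectorSpan ℝ (s : Set (Eucl n))

/-- The closed simplex with vertex set `s`. -/
abbrev Simp {n : ℕ} (s : Finset (Eucl n)) : Set (Eucl n) := convexHull ℝ (s : Set (Eucl n))

/-- The fields of alternating `k`-forms on the closed simplex `s`: functions that map every point of
the simplex to an alternating `k`-form on the tangent space. -/
def FormField {n : ℕ} (k : ℕ) (s : Finset (Eucl n)) := Simp s → Dir s [⋀^Fin k]→L[ℝ] ℝ

instance {n : ℕ} (k : ℕ) (s : Finset (Eucl n)) : AddCommGroup (FormField k s) :=
  inferInstanceAs (AddCommGroup (Simp s → Dir s [⋀^Fin k]→L[ℝ] ℝ))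

instance {n : ℕ} (k : ℕ) (s : Finset (Eucl n)) : Module ℝ (FormField k s) :=
  inferInstanceAs (Module ℝ (Simp s → Dir s [⋀^Fin k]→L[ℝ] ℝ))

/-- Pullback to the simplex `s` of a differential `k`-form on `ℝⁿ`. -/
def pull {n : ℕ} (k : ℕ) (s : Finset (Eucl n)) (η : Eucl n → Eucl n [⋀^Fin k]→L[ℝ] ℝ) :
    FormField k s :=
  fun x => (η x).compContinuousLinearMap (Dir s).subtypeL

theorem pull_add {n : ℕ} (k : ℕ) (s : Finset (Eucl n))
    (η ζ : Eucl n → Eucl n [⋀^Fin k]→L[ℝ] ℝ) :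
    pull k s (η + ζ) = pull k s η + pull k s ζ := rfl

theorem pull_smul {n : ℕ} (k : ℕ) (s : Finset (Eucl n)) (c : ℝ)
    (η : Eucl n → Eucl n [⋀^Fin k]→L[ℝ] ℝ) :
    pull k s (c • η) = c • pull k s η := rfl

/-- The smooth differential `k`-forms on the closed simplex `s`: the pullbacks of the smooth
differential `k`-forms on `ℝⁿ`. -/
def SmoothForm {n : ℕ} (k : ℕ) (s : Finset (Eucl n)) : Submodule ℝ (FormField k s) where
  carrier := {ω | ∃ η : Eucl n → Eucl n [⋀^Fin k]→L[ℝ] ℝ,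
    ContDiff ℝ (⊤ : ℕ∞) η ∧ ω = pull k s η}
  zero_mem' := ⟨0, contDiff_const, rfl⟩
  add_mem' := by
    rintro _ _ ⟨η, hη, rfl⟩ ⟨ζ, hζ, rfl⟩
    exact ⟨η + ζ, hη.add hζ, rfl⟩
  smul_mem' := by
    rintro c _ ⟨η, hη, rfl⟩
    exact ⟨c • η, contDiff_const.smul hη, rfl⟩

/-- The pullback of `dη` to the simplex vanishes if the pullback of `η` does. -/
theorem pull_extDeriv_eq_zero {n : ℕ} (k : ℕ) (s : Finset (Eucl n))
    (η : Eucl n → Eucl n [⋀^Fin k]→L[ℝ] ℝ) (hη : ContDiff ℝ (⊤ : ℕ∞) η) (h : pull k s η = 0) :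
    pull (k + 1) s (extDeriv η) = 0 := by
  have hd : Differentiable ℝ η := hη.differentiable (by simp)
  have key : ∀ x ∈ Simp s, ∀ v ∈ Dir s, ∀ w : Fin k → Dir s,
      fderiv ℝ (fun y => η y (fun i => (w i : Eucl n))) x v = 0 := by
    intro x hx v hv w
    have hv' : v ∈ Submodule.span ℝ ((fun y => y - x) '' Simp s) := by
      have h1 : Dir s ≤ vectorSpan ℝ (Simp s) := vectorSpan_mono ℝ (subset_convexHull ℝ _)
      have h2 := h1 hv
      rwa [vectorSpan_eq_span_vsub_set_right ℝ hx] at h2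
    have hdw : Differentiable ℝ (fun y => η y (fun i => (w i : Eucl n))) := fun y =>
      ((ContinuousAlternatingMap.apply ℝ (Eucl n) ℝ
        (fun i => (w i : Eucl n))).differentiableAt).comp y (hd y)
    refine Submodule.span_induction (p := fun v _ =>
      fderiv ℝ (fun y => η y (fun i => (w i : Eucl n))) x v = 0) ?_ (by simp) ?_ ?_ hv'
    · rintro _ ⟨y, hy, rfl⟩
      have hline : HasDerivAt (fun t : ℝ => x + t • (y - x)) (y - x) 0 := by
        simpa using ((hasDerivAt_id (0 : ℝ)).smul_const (y - x)).const_add x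
      have hg : HasDerivAt (fun t : ℝ => η (x + t • (y - x)) (fun i => (w i : Eucl n)))
          (fderiv ℝ (fun y => η y (fun i => (w i : Eucl n))) (x + (0 : ℝ) • (y - x)) (y - x)) 0 :=
        HasFDerivAt.comp_hasDerivAt (f := fun t : ℝ => x + t • (y - x)) (0 : ℝ)
          (hdw (x + (0 : ℝ) • (y - x))).hasFDerivAt hline
      rw [zero_smul, add_zero] at hg
      have hz : HasDerivWithinAt (fun t : ℝ => η (x + t • (y - x)) (fun i => (w i : Eucl n)))
          0 (Set.Icc 0 1) 0 := by
        refine (hasDerivWithinAt_const (0 : ℝ) (Set.Icc (0 : ℝ) 1) (0 : ℝ)).congr_of_mem ?_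
          (by simp)
        intro t ht
        have hm : x + t • (y - x) ∈ Simp s :=
          (convex_convexHull ℝ _).add_smul_sub_mem hx hy ht
        exact congrArg (fun α => α w) (congrFun h ⟨_, hm⟩)
      exact (uniqueDiffOn_Icc (by norm_num : (0 : ℝ) < 1) 0 (by simp)).eq_deriv _
        hg.hasDerivWithinAt hz
    · intro a b _ _ ha hb
      rw [map_add, ha, hb, add_zero]
    · intro c a _ ha
      rw [map_smul, ha, smul_zero]
  funext x
  ext v
  have h0 := extDeriv_apply (hd x) (fun i => (v i : Eucl n))
  change extDeriv η x (fun i => (v i : Eucl n)) = 0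
  rw [h0]
  refine Finset.sum_eq_zero fun i _ => ?_
  have h1 : fderiv ℝ (fun y => η y (i.removeNth fun j => (v j : Eucl n))) x (v i) = 0 :=
    key x x.2 (v i) (v i).2 (i.removeNth v)
  rw [h1, smul_zero]

theorem contDiff_extDeriv {n : ℕ} {k : ℕ} {η : Eucl n → Eucl n [⋀^Fin k]→L[ℝ] ℝ}
    (hη : ContDiff ℝ (⊤ : ℕ∞) η) : ContDiff ℝ (⊤ : ℕ∞) (extDeriv η) :=
  (ContinuousAlternatingMap.alternatizeUncurryFinCLM ℝ (Eucl n) ℝ (n := k)).contDiff.comp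
    (hη.fderiv_right (by simp))

theorem pull_extDeriv_add {n : ℕ} (k : ℕ) (s : Finset (Eucl n))
    {η ζ : Eucl n → Eucl n [⋀^Fin k]→L[ℝ] ℝ} (hη : ContDiff ℝ (⊤ : ℕ∞) η)
    (hζ : ContDiff ℝ (⊤ : ℕ∞) ζ) :
    pull (k + 1) s (extDeriv (η + ζ)) =
      pull (k + 1) s (extDeriv η) + pull (k + 1) s (extDeriv ζ) := by
  rw [← pull_add]
  congr 1
  funext x
  exact extDeriv_add (hη.differentiable (by simp) x) (hζ.differentiable (by simp) x)

theorem pull_extDeriv_smul {n : ℕ} (k : ℕ) (s : Finset (Eucl n)) (c : ℝ)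
    (η : Eucl n → Eucl n [⋀^Fin k]→L[ℝ] ℝ) :
    pull (k + 1) s (extDeriv (c • η)) = c • pull (k + 1) s (extDeriv η) := by
  rw [← pull_smul]
  congr 1
  funext x
  exact extDeriv_smul c η

theorem pull_extDeriv_congr {n : ℕ} (k : ℕ) (s : Finset (Eucl n))
    {η ζ : Eucl n → Eucl n [⋀^Fin k]→L[ℝ] ℝ} (hη : ContDiff ℝ (⊤ : ℕ∞) η)
    (hζ : ContDiff ℝ (⊤ : ℕ∞) ζ) (h : pull k s η = pull k s ζ) :
    pull (k + 1) s (extDeriv η) = pull (k + 1) s (extDeriv ζ) := by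
  have h0 : pull k s (η + (-1 : ℝ) • ζ) = 0 := by
    rw [pull_add, pull_smul, h, neg_one_smul, add_neg_cancel]
  have hζ' : ContDiff ℝ (⊤ : ℕ∞) ((-1 : ℝ) • ζ) := contDiff_const.smul hζ
  have h1 : pull (k + 1) s (extDeriv (η + (-1 : ℝ) • ζ)) = 0 :=
    pull_extDeriv_eq_zero k s _ (hη.add hζ') h0
  rwa [pull_extDeriv_add k s hη hζ', pull_extDeriv_smul, neg_one_smul,
    add_neg_eq_zero] at h1

/-- The exterior derivative of a smooth form on the simplex `s`: the pullback of `dη`, where `η`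
is any smooth form on `ℝⁿ` that extends it (see `dForm_eq`). -/
def dForm {n : ℕ} (k : ℕ) (s : Finset (Eucl n)) : SmoothForm k s →ₗ[ℝ] SmoothForm (k + 1) s where
  toFun ω := ⟨pull (k + 1) s (extDeriv ω.2.choose),
    ⟨_, contDiff_extDeriv ω.2.choose_spec.1, rfl⟩⟩
  map_add' ω ω' := by
    apply Subtype.ext
    obtain ⟨e1, f1⟩ := ω.2.choose_spec
    obtain ⟨e2, f2⟩ := ω'.2.choose_spec
    obtain ⟨e3, f3⟩ := (ω + ω').2.choose_spec
    have h : pull k s (ω + ω').2.choose = pull k s (ω.2.choose + ω'.2.choose) := by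
      rw [← f3, pull_add, ← f1, ← f2]
      rfl
    exact (pull_extDeriv_congr k s e3 (e1.add e2) h).trans (pull_extDeriv_add k s e1 e2)
  map_smul' c ω := by
    apply Subtype.ext
    obtain ⟨e1, f1⟩ := ω.2.choose_spec
    obtain ⟨e3, f3⟩ := (c • ω).2.choose_spec
    have h : pull k s (c • ω).2.choose = pull k s (c • ω.2.choose) := by
      rw [← f3, pull_smul, ← f1]
      rfl
    exact (pull_extDeriv_congr k s e3 (contDiff_const.smul e1) h).trans
      (pull_extDeriv_smul k s c _)

theorem dForm_eq {n : ℕ} {k : ℕ} {s : Finset (Eucl n)} (ω : SmoothForm k s)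
    {η : Eucl n → Eucl n [⋀^Fin k]→L[ℝ] ℝ} (hη : ContDiff ℝ (⊤ : ℕ∞) η)
    (h : (ω : FormField k s) = pull k s η) :
    (dForm k s ω : FormField (k + 1) s) = pull (k + 1) s (extDeriv η) :=
  pull_extDeriv_congr k s ω.2.choose_spec.1 hη (ω.2.choose_spec.2.symm.trans h)

/-- The pullback of a field of alternating forms along the inclusion of a subsimplex `F` of `C`. -/
def FormField.restrict {n : ℕ} {k : ℕ} {F C : Finset (Eucl n)} (h : F ⊆ C) (ω : FormField k C) :
    FormField k F :=
  fun x => (ω ⟨x, convexHull_mono (Finset.coe_subset.2 h) x.2⟩).compContinuousLinearMap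
    ((Dir F).subtypeL.codRestrict (Dir C)
      fun v => vectorSpan_mono ℝ (Finset.coe_subset.2 h) v.2)

theorem FormField.restrict_pull {n : ℕ} {k : ℕ} {F C : Finset (Eucl n)} (h : F ⊆ C)
    (η : Eucl n → Eucl n [⋀^Fin k]→L[ℝ] ℝ) : (pull k C η).restrict h = pull k F η := rfl

/-- The (tangential) trace of a smooth form from the simplex `C` to a subsimplex `F`: the pullback
along the inclusion. -/
def trace {n : ℕ} (k : ℕ) {F C : Finset (Eucl n)} (h : F ⊆ C) :
    SmoothForm k C →ₗ[ℝ] SmoothForm k F where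
  toFun ω := ⟨(ω : FormField k C).restrict h, by
    obtain ⟨ω, η, hη, rfl⟩ := ω
    exact ⟨η, hη, rfl⟩⟩
  map_add' _ _ := rfl
  map_smul' _ _ := rfl

/-- The indicator function `1_C` of the simplex `C`, as a smooth `0`-form on `C`. -/
def indicator {n : ℕ} (C : Finset (Eucl n)) : SmoothForm 0 C :=
  ⟨fun _ => ContinuousAlternatingMap.constOfIsEmpty ℝ (Dir C) (Fin 0) 1,
    ⟨fun _ => ContinuousAlternatingMap.constOfIsEmpty ℝ (Eucl n) (Fin 0) 1, contDiff_const, rfl⟩⟩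

/-! ### Triangulations with finite element spaces -/

/-- The `m`-dimensional simplices `𝒯^m` of a simplicial complex. -/
abbrev Face {n : ℕ} (T : Geometry.SimplicialComplex ℝ (Eucl n)) (m : ℕ) :=
  {s : Finset (Eucl n) // s ∈ T.faces ∧ s.card = m + 1}

/-- A finite `n`-dimensional simplicial complex `𝒯` in `ℝⁿ` with a subcomplex `𝒰`, an orientation
of every simplex, and on every simplex a finite-dimensional complex of smooth differential forms
such that the traces are surjective. (Only the spaces on the simplices of `𝒯` matter.) -/
structure FEComplex (n : ℕ) where
  T : Geometry.SimplicialComplex ℝ (Eucl n)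
  U : Geometry.SimplicialComplex ℝ (Eucl n)
  finite_faces : T.faces.Finite
  exists_supersimplex : ∀ s ∈ T.faces, ∃ C ∈ T.faces, s ⊆ C ∧ C.card = n + 1
  subcomplex : U.faces ⊆ T.faces
  orient : ∀ (m : ℕ) (C : Face T m), Orientation ℝ (Dir C.1) (Fin m)
  space : ∀ (k : ℕ) (s : Finset (Eucl n)), Submodule ℝ (SmoothForm k s)
  finiteDimensional : ∀ k, ∀ s ∈ T.faces, FiniteDimensional ℝ (space k s)
  dForm_mem : ∀ k, ∀ s ∈ T.faces, ∀ ω ∈ space k s, dForm k s ω ∈ space (k + 1) s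
  map_trace : ∀ k, ∀ C ∈ T.faces, ∀ F ∈ T.faces, ∀ h : F ⊆ C,
    (space k C).map (trace k h) = space k F

namespace FEComplex

variable {n : ℕ} (A : FEComplex n)

/-- The vector `p - v` for `p ∈ F ⊆ C` and `v ∈ C`, as a tangent vector of `C`. -/
def vec {F C : Finset (Eucl n)} (h : F ⊆ C) {p v : Eucl n} (hp : p ∈ F) (hv : v ∈ C) : Dir C :=
  ⟨p -ᵥ v, vsub_mem_vectorSpan ℝ (Finset.mem_coe.2 (h hp)) (Finset.mem_coe.2 hv)⟩

/-- The orientation that `C` induces on its face `F` ("outward vector first") coincides with the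
chosen orientation of `F`. If the form `α` represents the orientation of `C`, then the induced
orientation is represented by the restriction to `F` of the contraction of `α` with the vector
`p - v`, which points out of `C` through `F`; here `p` is a vertex of `F` and `v` the
vertex of `C` opposite to `F`. -/
def InducesOrient {m : ℕ} (F : Face A.T m) (C : Face A.T (m + 1)) (h : F.1 ⊆ C.1) : Prop :=
  ∃ (p : Eucl n) (hp : p ∈ F.1) (v : Eucl n) (hv : v ∈ C.1), v ∉ F.1 ∧
    SameRay ℝ
      (((A.orient (m + 1) C).someVector.curryLeft (vec h hp hv)).compLinearMap
        (Submodule.inclusion (vectorSpan_mono ℝ (Finset.coe_subset.2 h))))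
      (A.orient m F).someVector

open Classical in
/-- The incidence number `o(F, C) = ±1` if `F` is a subsimplex of `C`, and `0` otherwise. -/
def incidence {m : ℕ} (F : Face A.T m) (C : Face A.T (m + 1)) : ℝ :=
  if h : F.1 ⊆ C.1 then (if A.InducesOrient F C h then 1 else -1) else 0

/-! ### Relative simplicial homology -/

/-- The `m`-simplices of `𝒯` that are in `K` but not in `L`. -/
abbrev RelFace (K L : Set (Finset (Eucl n))) (m : ℕ) := {C : Face A.T m // C.1 ∈ K ∧ C.1 ∉ L}

instance (K L : Set (Finset (Eucl n))) (m : ℕ) : Finite (A.RelFace K L m) := by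
  have : Finite A.T.faces := A.finite_faces
  exact Finite.of_injective (fun C : A.RelFace K L m => (⟨C.1.1, C.1.2.1⟩ : A.T.faces))
    fun C C' h => Subtype.ext (Subtype.ext (by simpa using h))

instance (K L : Set (Finset (Eucl n))) (m : ℕ) : Fintype (A.RelFace K L m) := Fintype.ofFinite _

/-- The relative simplicial chains `𝒞_m(K, L)` of subcomplexes `L ⊆ K` of `𝒯`: the vector space
with basis `K^m \ L^m`. -/
abbrev Chain (K L : Set (Finset (Eucl n))) (m : ℕ) := A.RelFace K L m → ℝ

/-- The relative simplicial boundary operator `∂_{m+1} : 𝒞_{m+1}(K, L) → 𝒞_m(K, L)`. -/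
def bdry (K L : Set (Finset (Eucl n))) (m : ℕ) : A.Chain K L (m + 1) →ₗ[ℝ] A.Chain K L m where
  toFun c F := ∑ C, A.incidence F.1 C.1 * c C
  map_add' c c' := by
    funext F
    simp [mul_add, Finset.sum_add_distrib]
  map_smul' r c := by
    funext F
    simp [Finset.mul_sum, mul_left_comm]

/-- The relative cycles, the kernel of `∂_m` (where `∂_0 = 0`). -/
def cycles (K L : Set (Finset (Eucl n))) : (m : ℕ) → Submodule ℝ (A.Chain K L m)
  | 0 => ⊤
  | m + 1 => LinearMap.ker (A.bdry K L m)

/-- The relative simplicial homology space `ℋ_m(K, L) = ker ∂_m / ran ∂_{m+1}`. -/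
abbrev Homology (K L : Set (Finset (Eucl n))) (m : ℕ) :=
  A.cycles K L m ⧸ (LinearMap.range (A.bdry K L m)).submoduleOf (A.cycles K L m)

/-! ### The three conditions -/

/-- The local exactness condition. -/
def LocalExactness : Prop :=
  ∀ C ∈ A.T.faces, C ∉ A.U.faces →
    (A.space 0 C ⊓ LinearMap.ker (dForm 0 C) = Submodule.span ℝ {indicator C}) ∧
    ∀ k, ∀ ω ∈ A.space (k + 1) C, dForm (k + 1) C ω = 0 → ∃ η ∈ A.space k C, dForm k C η = ω

/-- The forms in `Λ^k(F)` with vanishing traces on all proper subsimplices of `F`. -/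
def bubble (k : ℕ) (F : Finset (Eucl n)) : Submodule ℝ (SmoothForm k F) :=
  A.space k F ⊓ ⨅ (G : Finset (Eucl n)) (_ : G ∈ A.T.faces) (h : G ⊂ F),
    LinearMap.ker (trace k h.subset)

/-- The geometric decomposition condition. -/
def GeometricDecomposition : Prop :=
  ∃ ext : ∀ (k : ℕ) (F C : Finset (Eucl n)), A.bubble k F →ₗ[ℝ] SmoothForm k C,
    ∀ k, ∀ F ∈ A.T.faces, ∀ C ∈ A.T.faces, ∀ hFC : F ⊆ C, ∀ ω : A.bubble k F,
      ext k F C ω ∈ A.space k C ∧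
      trace k hFC (ext k F C ω) = ω ∧
      ∀ G ∈ A.T.faces, ∀ hGC : G ⊆ C,
        (F ⊆ G → trace k hGC (ext k F C ω) = ext k F G ω) ∧
        (¬ F ⊆ G → trace k hGC (ext k F C ω) = 0)

/-- The element patch `ℳ_F` around `F`. -/
def patch (F : Finset (Eucl n)) : Set (Finset (Eucl n)) :=
  {G | G ∈ A.T.faces ∧ ∃ C ∈ A.T.faces, C.card = n + 1 ∧ F ⊆ C ∧ G ⊆ C}

/-- The complex `𝒩_F`: the simplices of `ℳ_F` of dimension at most `n - 1` that do not contain `F`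
or belong to `𝒰`. -/
def patchBdry (F : Finset (Eucl n)) : Set (Finset (Eucl n)) :=
  {G | G ∈ A.patch F ∧ G.card ≤ n ∧ (¬ F ⊆ G ∨ G ∈ A.U.faces)}

/-- The local patch condition of `𝒯` relative to `𝒰`. -/
def LocalPatch : Prop :=
  ∀ F ∈ A.T.faces, ∀ m < n, Subsingleton (A.Homology (A.patch F) (A.patchBdry F) m)

/-! ### Discrete distributional differential forms -/

/-- The trace `Λ^k(C) → Λ^k(F)`. -/
def tr (k : ℕ) {F C : Finset (Eucl n)} (hC : C ∈ A.T.faces) (hF : F ∈ A.T.faces) (h : F ⊆ C) :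
    A.space k C →ₗ[ℝ] A.space k F :=
  (trace k h).restrict fun ω hω => by
    rw [← A.map_trace k C hC F hF h]; exact Submodule.mem_map_of_mem hω

/-- The exterior derivative `Λ^k(C) → Λ^{k+1}(C)`. -/
def dd (k : ℕ) {C : Finset (Eucl n)} (hC : C ∈ A.T.faces) :
    A.space k C →ₗ[ℝ] A.space (k + 1) C :=
  (dForm k C).restrict (A.dForm_mem k C hC)

/-- The simplices `𝒯^m \ 𝒰^m`. -/
abbrev Cell (m : ℕ) := A.RelFace A.T.faces A.U.faces m

/-- The space `Λ_{-1}^k(𝒯^m) = ⨁ Λ^k(C)`, where `C` ranges over `𝒯^m \ 𝒰^m`. -/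
abbrev Broken (k m : ℕ) := (C : A.Cell m) → A.space k C.1.1

/-- The horizontal differential `D_k^m : Λ_{-1}^k(𝒯^m) → Λ_{-1}^{k+1}(𝒯^m)`. -/
def D (k m : ℕ) : A.Broken k m →ₗ[ℝ] A.Broken (k + 1) m where
  toFun ω C := A.dd k C.1.2.1 (ω C)
  map_add' _ _ := by funext C; simp
  map_smul' _ _ := by funext C; simp

open Classical in
/-- The vertical differential `T_k^{m+1} : Λ_{-1}^k(𝒯^{m+1}) → Λ_{-1}^k(𝒯^m)`. -/
def Tv (k m : ℕ) : A.Broken k (m + 1) →ₗ[ℝ] A.Broken k m where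
  toFun ω F := ∑ C : A.Cell (m + 1), if h : F.1.1 ⊆ C.1.1 then
    A.incidence F.1 C.1 • A.tr k C.1.2.1 F.1.2.1 h (ω C) else 0
  map_add' ω ω' := by
    funext F
    simp only [Pi.add_apply, ← Finset.sum_add_distrib]
    exact Finset.sum_congr rfl fun C _ => by split_ifs <;> simp
  map_smul' c ω := by
    funext F
    simp only [Pi.smul_apply, RingHom.id_apply, Finset.smul_sum]
    exact Finset.sum_congr rfl fun C _ => by split_ifs <;> simp [smul_comm c]

/-- A choice of a scalar product on each of the spaces `Λ_{-1}^k(𝒯^m)`. -/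
abbrev ScalarProducts := ∀ k m : ℕ, InnerProductSpace.Core ℝ (A.Broken k m)

variable (S : A.ScalarProducts)

/-- The space `Λ_{-1}^k(𝒯^m)`, equipped with the chosen scalar product. -/
def HBroken (_ : A.ScalarProducts) (k m : ℕ) := A.Broken k m

instance (k m : ℕ) : NormedAddCommGroup (A.HBroken S k m) :=
  @InnerProductSpace.Core.toNormedAddCommGroup ℝ (A.Broken k m) _ _ _ (S k m)

instance (k m : ℕ) : InnerProductSpace ℝ (A.HBroken S k m) :=
  InnerProductSpace.ofCore (S k m).toCore

instance (k m : ℕ) : FiniteDimensional ℝ (A.HBroken S k m) := by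
  have : ∀ C : A.Cell m, FiniteDimensional ℝ (A.space k C.1.1) :=
    fun C => A.finiteDimensional k C.1.1 C.1.2.1
  exact inferInstanceAs (FiniteDimensional ℝ (A.Broken k m))

/-- The identity map from `Λ_{-1}^k(𝒯^m)` to the same space with the chosen scalar product. -/
def toH (k m : ℕ) : A.Broken k m ≃ₗ[ℝ] A.HBroken S k m where
  toFun ω := ω
  invFun ω := ω
  map_add' _ _ := rfl
  map_smul' _ _ := rfl

/-- A linear map between spaces `Λ_{-1}^k(𝒯^m)`, considered as a map between the same spaces with the
chosen scalar products. -/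
def lift {k m k' m' : ℕ} (f : A.Broken k m →ₗ[ℝ] A.Broken k' m') :
    A.HBroken S k m →ₗ[ℝ] A.HBroken S k' m' :=
  (A.toH S k' m').toLinearMap ∘ₗ f ∘ₗ (A.toH S k m).symm.toLinearMap

/-- The Hilbert space `⨁ Λ_{-1}^k(𝒯^m)` over all form degrees `0 ≤ k ≤ n` and all simplex
dimensions `0 ≤ m ≤ n`; the component of `ω` in `Λ_{-1}^k(𝒯^m)` is `ω (k, m)`. It is the orthogonal
direct sum of these spaces, and all spaces of discrete distributional differential forms are
subspaces of it. -/
abbrev Total := PiLp 2 fun p : Fin (n + 1) × Fin (n + 1) => A.HBroken S p.1 p.2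

/-- The horizontal differentials `D_k^m`, for all `k` and `m` at once. -/
def DD : A.Total S →ₗ[ℝ] A.Total S where
  toFun ω := WithLp.toLp 2 fun p => match p with
    | (⟨0, _⟩, _) => 0
    | (⟨k + 1, hk⟩, m) => A.lift S (A.D k m) (ω (⟨k, by omega⟩, m))
  map_add' ω ω' := by
    ext ⟨⟨_ | k, hk⟩, m⟩ : 1
    · exact (add_zero _).symm
    · exact (A.lift S (A.D k m)).map_add _ _
  map_smul' c ω := by
    ext ⟨⟨_ | k, hk⟩, m⟩ : 1
    · exact (smul_zero (A := A.HBroken S 0 m) c).symm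
    · exact (A.lift S (A.D k m)).map_smul _ _

/-- The vertical differentials `T_k^m`, for all `k` and `m` at once. -/
def TT : A.Total S →ₗ[ℝ] A.Total S where
  toFun ω := WithLp.toLp 2 fun p =>
    if h : (p.2 : ℕ) < n then A.lift S (A.Tv p.1 p.2) (ω (p.1, ⟨p.2 + 1, Nat.succ_lt_succ h⟩)) else 0
  map_add' ω ω' := by
    ext p : 1
    by_cases h : (p.2 : ℕ) < n <;> simp [h]
  map_smul' c ω := by
    ext p : 1
    by_cases h : (p.2 : ℕ) < n <;> simp [h]

/-- Multiplication of the components in `Λ_{-1}^k(𝒯^{n-i})` by `(-1)^i`. -/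
def sgn : A.Total S →ₗ[ℝ] A.Total S where
  toFun ω := WithLp.toLp 2 fun p => (-1 : ℝ) ^ (n - (p.2 : ℕ)) • ω p
  map_add' ω ω' := by ext p : 1; simp
  map_smul' c ω := by ext p : 1; simp [smul_comm c]

/-- The discrete distributional exterior derivative
`d ω = (-1)^i D ω - (-1)^i T ω` for `ω ∈ Λ_{-1}^k(𝒯^{n-i})`. -/
def d : A.Total S →ₗ[ℝ] A.Total S := (A.DD S - A.TT S) ∘ₗ A.sgn S

/-- The forms all of whose components with an index outside of `I` vanish. -/
def supported (I : Set (ℕ × ℕ)) : Submodule ℝ (A.Total S) where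
  carrier := {ω | ∀ p : Fin (n + 1) × Fin (n + 1), ((p.1 : ℕ), (p.2 : ℕ)) ∉ I → ω p = 0}
  zero_mem' _ _ := rfl
  add_mem' h h' p hp := by simp [h p hp, h' p hp]
  smul_mem' c ω h p hp := by simp [h p hp]

/-- The space `Λ_{-b}^k(𝒯^m)`, i.e. `⨁_{0 ≤ j < b} Λ_{-1}^{k-j}(𝒯^{m-j})` for `b ≥ 1`, and
`Λ_0^k(𝒯^m) = Λ^k(𝒯^m) = {ω ∈ Λ_{-1}^k(𝒯^m) | T ω = 0}` for `b = 0`. The space is zero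
for `k < 0`. -/
def Lam (k : ℤ) (m : ℕ) : ℕ → Submodule ℝ (A.Total S)
  | 0 => A.supported S {q | (q.1 : ℤ) = k ∧ q.2 = m} ⊓ LinearMap.ker (A.TT S)
  | b + 1 => A.supported S {q | ∃ j < b + 1, (q.1 : ℤ) + j = k ∧ q.2 + j = m}

/-- The space `Γ_{-b}^k(𝒯^m)`, i.e. `⨁_{0 ≤ j < b} Λ_{-1}^{k+j}(𝒯^{m+j})` for `b ≥ 1`, and
`Γ_0^k(𝒯^m) = Γ^k(𝒯^m) = {ω ∈ Λ_{-1}^k(𝒯^m) | D ω = 0}` for `b = 0`. -/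
def Gam (k m : ℕ) : ℕ → Submodule ℝ (A.Total S)
  | 0 => A.supported S {q | q.1 = k ∧ q.2 = m} ⊓ LinearMap.ker (A.DD S)
  | b + 1 => A.supported S {q | ∃ j < b + 1, q.1 = k + j ∧ q.2 = m + j}

/-! ### Harmonic spaces -/

/-- The harmonic space `ℌ^k(𝒯^m)` of the complex `… → Λ^k(𝒯^m) → Λ^{k+1}(𝒯^m) → …` with the
differentials `D`; for `m = n` these are the discrete harmonic forms. -/
def harm (k : ℤ) (m : ℕ) : Submodule ℝ (A.Total S) :=
  A.Lam S k m 0 ⊓ LinearMap.ker (A.DD S) ⊓ ((A.Lam S (k - 1) m 0).map (A.DD S))ᗮ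

/-- The harmonic space `ℭ^k(𝒯^m)` of the complex `… → Γ^k(𝒯^m) → Γ^k(𝒯^{m-1}) → …` with the
differentials `T`. -/
def vharm (k m : ℕ) : Submodule ℝ (A.Total S) :=
  A.Gam S k m 0 ⊓ LinearMap.ker (A.TT S) ⊓ ((A.Gam S k (m + 1) 0).map (A.TT S))ᗮ

/-- The distributional harmonic space `ℌ_{-b}^k(𝒯^m)`, for `b ≥ 1`. -/
def distHarm (k : ℤ) (m b : ℕ) : Submodule ℝ (A.Total S) :=
  A.Lam S k m b ⊓ LinearMap.ker (A.d S) ⊓ ((A.Lam S (k - 1) m (b - 1)).map (A.d S))ᗮ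

/-- The distributional harmonic space `ℭ_{-b}^k(𝒯^m)`, for `b ≥ 1`. -/
def distVharm (k m b : ℕ) : Submodule ℝ (A.Total S) :=
  A.Gam S k m b ⊓ LinearMap.ker (A.d S) ⊓ ((A.Gam S k (m + 1) (b - 1)).map (A.d S))ᗮ

/-- The indicator function of `C ∈ 𝒯^m \ 𝒰^m` as an element of `Λ^0(C)`. -/
def indicatorForm (hA : A.LocalExactness) {m : ℕ} (C : A.Cell m) : A.space 0 C.1.1 :=
  ⟨indicator C.1.1, ((hA C.1.1 C.2.1 C.2.2).1.ge (Submodule.mem_span_singleton_self _)).1⟩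

/-- The element `∑ c_C 1_C` of `Λ_{-1}^0(𝒯^m)` that corresponds to the chain `∑ c_C C`. -/
def chainForm (hA : A.LocalExactness) {m : ℕ} (hm : m ≤ n)
    (c : A.Chain A.T.faces A.U.faces m) : A.Total S :=
  WithLp.toLp 2 (Pi.single (⟨0, n.succ_pos⟩, ⟨m, Nat.lt_succ_of_le hm⟩)
    (A.toH S 0 m fun C => c C • A.indicatorForm hA C))

/-! ### The regularizers -/

/-- The projection of `ω` onto its component in `Λ_{-1}^k(𝒯^m)`. -/
def component (k m : ℕ) : A.Total S →ₗ[ℝ] A.Total S where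
  toFun ω := WithLp.toLp 2 fun p => if (p.1 : ℕ) = k ∧ (p.2 : ℕ) = m then ω p else 0
  map_add' ω ω' := by ext p : 1; by_cases h : (p.1 : ℕ) = k ∧ (p.2 : ℕ) = m <;> simp [h]
  map_smul' c ω := by ext p : 1; by_cases h : (p.1 : ℕ) = k ∧ (p.2 : ℕ) = m <;> simp [h]

/-- A family of operators `E_k^{m+1} : Λ_{-1}^k(𝒯^m) → Λ_{-1}^k(𝒯^{m+1})`. -/
abbrev VertOps := ∀ k m : ℕ, A.Broken k m →ₗ[ℝ] A.Broken k (m + 1)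

/-- A family of operators `P_k^m : Λ_{-1}^{k+1}(𝒯^m) → Λ_{-1}^k(𝒯^m)`. -/
abbrev HorizOps := ∀ k m : ℕ, A.Broken (k + 1) m →ₗ[ℝ] A.Broken k m

/-- The operators `E_k^m` are generalized inverses of the operators `T_k^m`, i.e. `T E T = T`. -/
def IsVertInverse (E : A.VertOps) : Prop :=
  ∀ k m, A.Tv k m ∘ₗ E k m ∘ₗ A.Tv k m = A.Tv k m

/-- The operators `P_k^m` are generalized inverses of the operators `D_k^m`, i.e. `D P D = D`. -/
def IsHorizInverse (P : A.HorizOps) : Prop :=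
  ∀ k m, A.D k m ∘ₗ P k m ∘ₗ A.D k m = A.D k m

/-- The operators `E_k^m`, for all `k` and `m` at once. -/
def EE (E : A.VertOps) : A.Total S →ₗ[ℝ] A.Total S where
  toFun ω := WithLp.toLp 2 fun p => match p with
    | (_, ⟨0, _⟩) => 0
    | (k, ⟨m + 1, hm⟩) => A.lift S (E k m) (ω (k, ⟨m, by omega⟩))
  map_add' ω ω' := by
    ext ⟨k, ⟨_ | m, hm⟩⟩ : 1
    · exact (add_zero _).symm
    · exact (A.lift S (E k m)).map_add _ _
  map_smul' c ω := by
    ext ⟨k, ⟨_ | m, hm⟩⟩ : 1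
    · exact (smul_zero (A := A.HBroken S k 0) c).symm
    · exact (A.lift S (E k m)).map_smul _ _

/-- The operators `P_k^m`, for all `k` and `m` at once. -/
def PP (P : A.HorizOps) : A.Total S →ₗ[ℝ] A.Total S where
  toFun ω := WithLp.toLp 2 fun p =>
    if h : (p.1 : ℕ) < n then A.lift S (P p.1 p.2) (ω (⟨p.1 + 1, Nat.succ_lt_succ h⟩, p.2)) else 0
  map_add' ω ω' := by
    ext p : 1
    by_cases h : (p.1 : ℕ) < n <;> simp [h]
  map_smul' c ω := by
    ext p : 1
    by_cases h : (p.1 : ℕ) < n <;> simp [h]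

/-- The formula `ω ↦ ω - (-1)^{b+1} d E_{k-b+1}^{n-b+2} ω`, where `E_{k-b+1}^{n-b+2}` acts on the
component of `ω` in `Λ_{-1}^{k-b+1}(𝒯^{n-b+1})`. -/
def preR (E : A.VertOps) (k b : ℕ) : A.Total S →ₗ[ℝ] A.Total S :=
  LinearMap.id -
    (-1 : ℝ) ^ (b + 1) • (A.d S ∘ₗ A.EE S E ∘ₗ A.component S (k + 1 - b) (n + 1 - b))

/-- The formula `ω ↦ ω + (-1)^{b+n-m} d P_{b-2}^{m+b-1} ω`, where `P_{b-2}^{m+b-1}` acts on the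
component of `ω` in `Λ_{-1}^{b-1}(𝒯^{m+b-1})`. -/
def preS (P : A.HorizOps) (m b : ℕ) : A.Total S →ₗ[ℝ] A.Total S :=
  LinearMap.id +
    (-1 : ℝ) ^ (b + (n - m)) • (A.d S ∘ₗ A.PP S P ∘ₗ A.component S (b - 1) (m + b - 1))

theorem DD_mem {I J : Set (ℕ × ℕ)} (h : ∀ k m, (k, m) ∈ I → (k + 1, m) ∈ J) {ω : A.Total S}
    (hω : ω ∈ A.supported S I) : A.DD S ω ∈ A.supported S J := by
  rintro ⟨⟨_ | k, hk⟩, m⟩ hp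
  · rfl
  · have h0 : ω (⟨k, by omega⟩, m) = 0 := hω _ fun hI => hp (h _ _ hI)
    exact (congrArg (A.lift S (A.D k m)) h0).trans (A.lift S (A.D k m)).map_zero

theorem TT_mem {I J : Set (ℕ × ℕ)} (h : ∀ k m, (k, m + 1) ∈ I → (k, m) ∈ J) {ω : A.Total S}
    (hω : ω ∈ A.supported S I) : A.TT S ω ∈ A.supported S J := by
  intro p hp
  by_cases hm : (p.2 : ℕ) < n
  · have h0 : ω (p.1, ⟨p.2 + 1, Nat.succ_lt_succ hm⟩) = 0 := hω _ fun hI => hp (h _ _ hI)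
    exact (dif_pos hm).trans ((congrArg (A.lift S (A.Tv p.1 p.2)) h0).trans
      (A.lift S (A.Tv p.1 p.2)).map_zero)
  · exact dif_neg hm

theorem EE_mem (E : A.VertOps) {I J : Set (ℕ × ℕ)} (h : ∀ k m, (k, m) ∈ I → (k, m + 1) ∈ J)
    {ω : A.Total S} (hω : ω ∈ A.supported S I) : A.EE S E ω ∈ A.supported S J := by
  rintro ⟨k, ⟨_ | m, hm⟩⟩ hp
  · rfl
  · have h0 : ω (k, ⟨m, by omega⟩) = 0 := hω _ fun hI => hp (h _ _ hI)
    exact (congrArg (A.lift S (E k m)) h0).trans (A.lift S (E k m)).map_zero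

theorem PP_mem (P : A.HorizOps) {I J : Set (ℕ × ℕ)} (h : ∀ k m, (k + 1, m) ∈ I → (k, m) ∈ J)
    {ω : A.Total S} (hω : ω ∈ A.supported S I) : A.PP S P ω ∈ A.supported S J := by
  intro p hp
  by_cases hm : (p.1 : ℕ) < n
  · have h0 : ω (⟨p.1 + 1, Nat.succ_lt_succ hm⟩, p.2) = 0 := hω _ fun hI => hp (h _ _ hI)
    exact (dif_pos hm).trans ((congrArg (A.lift S (P p.1 p.2)) h0).trans
      (A.lift S (P p.1 p.2)).map_zero)
  · exact dif_neg hm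

theorem d_mem {I J : Set (ℕ × ℕ)} (hD : ∀ k m, (k, m) ∈ I → (k + 1, m) ∈ J)
    (hT : ∀ k m, (k, m + 1) ∈ I → (k, m) ∈ J) {ω : A.Total S}
    (hω : ω ∈ A.supported S I) : A.d S ω ∈ A.supported S J := by
  have h : A.sgn S ω ∈ A.supported S I := fun p hp => by simp [sgn, hω p hp]
  exact Submodule.sub_mem _ (A.DD_mem S hD h) (A.TT_mem S hT h)

theorem component_mem (k m : ℕ) (ω : A.Total S) :
    A.component S k m ω ∈ A.supported S {(k, m)} := by
  intro p hp
  have : ¬ ((p.1 : ℕ) = k ∧ (p.2 : ℕ) = m) := by simpa using hp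
  simp [component, this]

theorem preR_mem (E : A.VertOps) {k b : ℕ} (hb : 2 ≤ b) (hbk : b ≤ k + 1) (hk : k ≤ n)
    (ω : A.Total S) (hω : ω ∈ A.Lam S k n b) : A.preR S E k b ω ∈ A.Lam S k n b := by
  obtain ⟨b, rfl⟩ : ∃ c, b = c + 2 := ⟨b - 2, by omega⟩
  refine Submodule.sub_mem _ hω (Submodule.smul_mem _ _ ?_)
  refine A.d_mem S (I := {(k - (b + 1), n - b)}) ?_ ?_ (A.EE_mem S E ?_ (A.component_mem S _ _ ω))
  · rintro k' m h
    obtain ⟨rfl, rfl⟩ := Prod.mk.inj h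
    exact ⟨b, by omega, by push_cast; omega, by dsimp only; omega⟩
  · rintro k' m h
    obtain ⟨rfl, h2⟩ := Prod.mk.inj h
    exact ⟨b + 1, by omega, by push_cast; omega, by dsimp only; omega⟩
  · rintro k' m h
    obtain ⟨rfl, rfl⟩ := Prod.mk.inj h
    exact Prod.ext (by dsimp only; omega) (by dsimp only; omega)

theorem preS_mem (P : A.HorizOps) {m b : ℕ} (hb : 2 ≤ b)
    (ω : A.Total S) (hω : ω ∈ A.Gam S 0 m b) : A.preS S P m b ω ∈ A.Gam S 0 m b := by
  obtain ⟨b, rfl⟩ : ∃ c, b = c + 2 := ⟨b - 2, by omega⟩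
  refine Submodule.add_mem _ hω (Submodule.smul_mem _ _ ?_)
  refine A.d_mem S (I := {(b, m + (b + 1))}) ?_ ?_ (A.PP_mem S P ?_ (A.component_mem S _ _ ω))
  · rintro k' m' h
    obtain ⟨rfl, rfl⟩ := Prod.mk.inj h
    exact ⟨k' + 1, by omega, by dsimp only; omega, rfl⟩
  · rintro k' m' h
    obtain ⟨rfl, h2⟩ := Prod.mk.inj h
    exact ⟨k', by omega, by dsimp only; omega, by dsimp only; omega⟩
  · rintro k' m' h
    obtain ⟨h1, h2⟩ := Prod.mk.inj h
    exact Prod.ext (by dsimp only; omega) (by dsimp only; omega)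

/-- The regularizer `R_{k,b} : Λ_{-b}^k(𝒯^n) → Λ_{-b}^k(𝒯^n)`, for `2 ≤ b ≤ k + 1`. -/
def R (E : A.VertOps) {k b : ℕ} (hb : 2 ≤ b) (hbk : b ≤ k + 1) (hk : k ≤ n) :
    A.Lam S k n b →ₗ[ℝ] A.Lam S k n b :=
  (A.preR S E k b).restrict (A.preR_mem S E hb hbk hk)

/-- The regularizer `S_{m,b} : Γ_{-b}^0(𝒯^m) → Γ_{-b}^0(𝒯^m)`, for `2 ≤ b ≤ n - m + 1`. -/
def regS (P : A.HorizOps) (m : ℕ) {b : ℕ} (hb : 2 ≤ b) : A.Gam S 0 m b →ₗ[ℝ] A.Gam S 0 m b :=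
  (A.preS S P m b).restrict (A.preS_mem S P hb)

/-- The operator `Q_b^k R_{k,b}^*` on `Λ_{-b}^k(𝒯^n)`: the adjoint of `R_{k,b}`, followed by the
orthogonal projection `Q_b^k` onto the kernel of `d` in `Λ_{-b}^k(𝒯^n)`. -/
def QR (E : A.VertOps) {k b : ℕ} (hb : 2 ≤ b) (hbk : b ≤ k + 1) (hk : k ≤ n) :
    A.Lam S k n b →ₗ[ℝ] A.Lam S k n b :=
  (LinearMap.ker ((A.d S).domRestrict (A.Lam S k n b))).starProjection.toLinearMap ∘ₗ
    LinearMap.adjoint (A.R S E hb hbk hk)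

/-- The operator `Q_b^m S_{m,b}^*` on `Γ_{-b}^0(𝒯^m)`: the adjoint of `S_{m,b}`, followed by the
orthogonal projection `Q_b^m` onto the kernel of `d` in `Γ_{-b}^0(𝒯^m)`. -/
def QS (P : A.HorizOps) (m : ℕ) {b : ℕ} (hb : 2 ≤ b) : A.Gam S 0 m b →ₗ[ℝ] A.Gam S 0 m b :=
  (LinearMap.ker ((A.d S).domRestrict (A.Gam S 0 m b))).starProjection.toLinearMap ∘ₗ
    LinearMap.adjoint (A.regS S P m hb)

end FEComplex

end FEDist

/-!
The differentials `D` and `T` form a double complex. Its rows are exact by local exactness. Its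
columns are exact below the top dimension: a `T`-closed form is made to vanish on ever larger faces
`F`, where its traces are bubbles on `F`, so that their coefficients form relative cycles of the
patch `(ℳ_F, 𝒩_F)`; these bound, and geometric decomposition extends the bounding bubbles.

If `ω` is in `Λ_{-b}` and `𝐝 ω = 0`, then the component of `ω` on the simplices of lowest dimension
is `T`-closed, hence `T`-exact, and subtracting an exact form moves `ω` to `Λ_{-b+1}`. So `R_{k,b}`
is a retraction of the closed forms onto those in `Λ_{-b+1}` that is the identity modulo exact
forms, and its adjoint maps harmonic forms isomorphically to harmonic forms, with the orthogonal
projection as inverse. The same holds for `S_{m,b}` with `D` in place of `T`. The two chains of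
isomorphisms meet at `b = k + 1`, where `Γ^0_{-b}(𝒯^{n-k})` and `Λ^k_{-b}(𝒯^n)` are sums over the
same antidiagonal, and `C ↦ 1_C` turns `∂` into `T` on the kernel of `D` in degree `0`.
-/

namespace FEDist

section LinearAlgebra

theorem exists_sum_smul_eq_of_forall_dual {R ι κ V : Type*} [CommRing R] [Fintype ι]
    [AddCommGroup V] [Module R V] [Module.Free R V] [Module.Finite R V] (M : κ → ι → R)
    (v : κ → V) (h : ∀ φ : Module.Dual R V, ∃ u : ι → R, ∀ x, ∑ i, M x i * u i = φ (v x)) :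
    ∃ u : ι → V, ∀ x, ∑ i, M x i • u i = v x := by
  let b := Module.Free.chooseBasis R V
  choose u hu using fun j => h (b.coord j)
  refine ⟨fun i => ∑ j, u j i • b j, fun x => ?_⟩
  calc ∑ i, M x i • ∑ j, u j i • b j = ∑ j, (∑ i, M x i * u j i) • b j := by
        simp only [Finset.smul_sum, Finset.sum_smul, smul_smul]
        exact Finset.sum_comm
    _ = v x := by simp only [hu, Module.Basis.coord_apply, b.sum_repr]

theorem alternatingMap_eq_zero_of_finrank_lt {𝕜 V W ι : Type*} [Field 𝕜] [AddCommGroup V]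
    [Module 𝕜 V] [FiniteDimensional 𝕜 V] [AddCommGroup W] [Module 𝕜 W] [Fintype ι]
    (h : Module.finrank 𝕜 V < Fintype.card ι) (α : V [⋀^ι]→ₗ[𝕜] W) : α = 0 :=
  AlternatingMap.ext fun v => α.map_linearDependent v fun hv =>
    hv.fintype_card_le_finrank.not_gt h

theorem curryLeft_curryLeft_swap {R M N : Type*} [CommRing R] [AddCommGroup M] [Module R M]
    [AddCommGroup N] [Module R N] {m : ℕ} (α : M [⋀^Fin (m + 2)]→ₗ[R] N) (x y : M) :
    (α.curryLeft x).curryLeft y = -(α.curryLeft y).curryLeft x := by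
  rw [eq_neg_iff_add_eq_zero]
  simpa using α.curryLeft_same (x + y)

theorem exists_alternatingMap_eq_smul {𝕜 V : Type*} [Field 𝕜] [AddCommGroup V] [Module 𝕜 V]
    [FiniteDimensional 𝕜 V] {m : ℕ} (h : Module.finrank 𝕜 V = m) {β : V [⋀^Fin m]→ₗ[𝕜] 𝕜}
    (hβ : β ≠ 0) (α : V [⋀^Fin m]→ₗ[𝕜] 𝕜) : ∃ c : 𝕜, α = c • β := by
  let e := Module.finBasisOfFinrankEq 𝕜 V h
  have hβe : β e ≠ 0 := (AlternatingMap.map_basis_ne_zero_iff e β).2 hβ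
  refine ⟨α e / β e, ?_⟩
  calc α = α e • e.det := α.eq_smul_basis_det e
    _ = (α e / β e) • β e • e.det := by rw [smul_smul, div_mul_cancel₀ _ hβe]
    _ = (α e / β e) • β := by rw [← β.eq_smul_basis_det e]

end LinearAlgebra

section Harmonic

open scoped InnerProductSpace

variable {𝕜 H : Type*} [RCLike 𝕜] [NormedAddCommGroup H] [InnerProductSpace 𝕜 H]

theorem exists_quotient_comap_equiv_inf_orthogonal {M : Type*} [AddCommGroup M] [Module 𝕜 M]
    (J : M →ₗ[𝕜] H) {B : Submodule 𝕜 H} [B.HasOrthogonalProjection]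
    (hB : B ≤ LinearMap.range J) :
    ∃ e : (M ⧸ B.comap J) ≃ₗ[𝕜] ↥(LinearMap.range J ⊓ Bᗮ),
      ∀ c, J c ∈ Bᗮ → (e (Submodule.Quotient.mk c) : H) = J c := by
  let f : M →ₗ[𝕜] H := Bᗮ.starProjection.toLinearMap ∘ₗ J
  have apply_f (c : M) : f c = J c - B.starProjection (J c) := B.starProjection_orthogonal_val _
  have ker_f : B.comap J = LinearMap.ker f := by
    rw [LinearMap.ker_comp, Submodule.ker_starProjection, Submodule.orthogonal_orthogonal]
  have range_f : LinearMap.range f = LinearMap.range J ⊓ Bᗮ := by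
    refine le_antisymm ?_ ?_
    · rintro _ ⟨c, rfl⟩
      refine ⟨?_, Bᗮ.starProjection_apply_mem _⟩
      rw [apply_f]
      exact sub_mem ⟨c, rfl⟩ (hB (B.starProjection_apply_mem _))
    · rintro _ ⟨⟨c, rfl⟩, hc⟩
      exact ⟨c, Submodule.starProjection_eq_self_iff.2 hc⟩
  let e := (Submodule.quotEquivOfEq _ _ ker_f).trans
    (f.quotKerEquivRange.trans (LinearEquiv.ofEq _ _ range_f))
  have e_mk (c : M) : (e (Submodule.Quotient.mk c) : H) = f c := rfl
  exact ⟨e, fun c hc => (e_mk c).trans (Bᗮ.starProjection_eq_self_iff.2 hc)⟩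

variable [FiniteDimensional 𝕜 H]

section Retraction

variable {Z Z' B : Submodule 𝕜 H} (hZ : Z' ≤ Z) (R : Z →ₗ[𝕜] Z')

theorem starProjection_adjoint_of_retraction (R_eq : ∀ z, R (Submodule.inclusion hZ z) = z)
    (h : Z') : Z'.starProjection (LinearMap.adjoint R h) = (h : H) := by
  refine Submodule.eq_starProjection_of_mem_of_inner_eq_zero h.2 fun z hz => ?_
  have R_z : R ⟨z, hZ hz⟩ = ⟨z, hz⟩ := R_eq ⟨z, hz⟩
  have inner_adjoint := LinearMap.adjoint_inner_left R ⟨z, hZ hz⟩ h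
  rw [R_z] at inner_adjoint
  rw [inner_sub_left, sub_eq_zero]
  exact inner_adjoint

variable {R}

theorem adjoint_mem_orthogonal (hB : B ≤ Z) (sub_R_mem : ∀ z : Z, (z : H) - R z ∈ B) {h : Z'}
    (hh : (h : H) ∈ (B ⊓ Z')ᗮ) : (LinearMap.adjoint R h : H) ∈ Bᗮ := by
  refine (Submodule.mem_orthogonal' _ _).2 fun b hb => ?_
  have hRb : (R ⟨b, hB hb⟩ : H) ∈ B ⊓ Z' :=
    ⟨by simpa using sub_mem hb (sub_R_mem ⟨b, hB hb⟩), (R ⟨b, hB hb⟩).2⟩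
  have orthogonal : ⟪(h : H), R ⟨b, hB hb⟩⟫_𝕜 = 0 :=
    Submodule.inner_left_of_mem_orthogonal hRb hh
  exact (LinearMap.adjoint_inner_left R ⟨b, hB hb⟩ h).trans orthogonal

theorem adjoint_orthogonalProjectionOnto (sub_R_mem : ∀ z : Z, (z : H) - R z ∈ B) {w : Z}
    (hw : (w : H) ∈ Bᗮ) : LinearMap.adjoint R (Z'.orthogonalProjectionOnto w) = w := by
  refine ext_inner_right 𝕜 fun z => ?_
  calc ⟪LinearMap.adjoint R (Z'.orthogonalProjectionOnto w), z⟫_𝕜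
      = ⟪Z'.starProjection w, R z⟫_𝕜 := LinearMap.adjoint_inner_left R z _
    _ = ⟪(w : H), R z⟫_𝕜 := by
      rw [Z'.inner_starProjection_left_eq_right, Z'.starProjection_eq_self_iff.2 (R z).2]
    _ = ⟪(w : H), z⟫_𝕜 := by
      have orthogonal := Submodule.inner_left_of_mem_orthogonal (sub_R_mem z) hw
      rw [inner_sub_right, sub_eq_zero] at orthogonal
      exact orthogonal.symm

theorem starProjection_mem_orthogonal_inf {w : H} (hw : w ∈ Bᗮ) :
    Z'.starProjection w ∈ (B ⊓ Z')ᗮ := by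
  refine (Submodule.mem_orthogonal' _ _).2 fun b hb => ?_
  rw [Z'.inner_starProjection_left_eq_right, Z'.starProjection_eq_self_iff.2 hb.2]
  exact Submodule.inner_left_of_mem_orthogonal hb.1 hw

-- The inverse is the orthogonal projection onto `Z'`.
theorem exists_equiv_adjoint_of_retraction {B' : Submodule 𝕜 H} (hB : B ≤ Z) (hB' : B' = B ⊓ Z')
    (sub_R_mem : ∀ z : Z, (z : H) - R z ∈ B) (R_eq : ∀ z, R (Submodule.inclusion hZ z) = z) :
    ∃ e : ↥(Z' ⊓ B'ᗮ) ≃ₗ[𝕜] ↥(Z ⊓ Bᗮ),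
      ∀ h : ↥(Z' ⊓ B'ᗮ), (e h : H) = LinearMap.adjoint R ⟨h, h.2.1⟩ := by
  subst hB'
  let F : ↥(Z' ⊓ (B ⊓ Z')ᗮ) →ₗ[𝕜] ↥(Z ⊓ Bᗮ) :=
    (Z.subtype ∘ₗ LinearMap.adjoint R ∘ₗ Submodule.inclusion inf_le_left).codRestrict _
      fun h => ⟨(LinearMap.adjoint R _).2, adjoint_mem_orthogonal hB sub_R_mem h.2.2⟩
  let G : ↥(Z ⊓ Bᗮ) →ₗ[𝕜] ↥(Z' ⊓ (B ⊓ Z')ᗮ) :=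
    (Z'.starProjection.toLinearMap.domRestrict _).codRestrict _
      fun w => ⟨Z'.starProjection_apply_mem _, starProjection_mem_orthogonal_inf w.2.2⟩
  refine ⟨LinearEquiv.ofLinearMap F G (LinearMap.ext fun w => Subtype.ext ?_)
    (LinearMap.ext fun h => Subtype.ext ?_), fun h => rfl⟩
  · exact congrArg (Subtype.val : Z → H)
      (adjoint_orthogonalProjectionOnto sub_R_mem (w := ⟨w, w.2.1⟩) w.2.2)
  · exact starProjection_adjoint_of_retraction hZ R R_eq ⟨h, h.2.1⟩

end Retraction

theorem exists_equiv_starProjection_adjoint (d : H →ₗ[𝕜] H) {X X' B B' : Submodule 𝕜 H}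
    (R : X →ₗ[𝕜] X) (hX : X' ≤ X) (hB : B ≤ X ⊓ LinearMap.ker d) (hB' : B' = B ⊓ X')
    (R_mem : ∀ z : X, d z = 0 → (R z : H) ∈ X') (sub_R_mem : ∀ z : X, d z = 0 → (z : H) - R z ∈ B)
    (R_eq : ∀ z : X, (z : H) ∈ X' → R z = z) :
    ∃ e : ↥(X' ⊓ LinearMap.ker d ⊓ B'ᗮ) ≃ₗ[𝕜] ↥(X ⊓ LinearMap.ker d ⊓ Bᗮ),
      ∀ h : ↥(X' ⊓ LinearMap.ker d ⊓ B'ᗮ), ∃ hh : (h : H) ∈ X,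
        (e h : H) = (LinearMap.ker (d.domRestrict X)).starProjection
          (LinearMap.adjoint R ⟨h, hh⟩) := by
  let K := LinearMap.ker (d.domRestrict X)
  have d_R (z : X) (hz : d z = 0) : d (R z) = 0 := by
    have : d (z - R z) = 0 := (hB (sub_R_mem z hz)).2
    rwa [map_sub, hz, zero_sub, neg_eq_zero] at this
  let R' : ↥(X ⊓ LinearMap.ker d) →ₗ[𝕜] ↥(X' ⊓ LinearMap.ker d) :=
    (X.subtype ∘ₗ R ∘ₗ Submodule.inclusion inf_le_left).codRestrict _
      fun z => ⟨R_mem _ z.2.2, d_R _ z.2.2⟩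
  have hB'ker : B' = B ⊓ (X' ⊓ LinearMap.ker d) := by
    rw [hB', ← inf_assoc, eq_comm, inf_eq_left]
    exact inf_le_left.trans (hB.trans inf_le_right)
  obtain ⟨e, he⟩ := exists_equiv_adjoint_of_retraction (R := R') (inf_le_inf_right _ hX) hB hB'ker
    (fun z => sub_R_mem ⟨z, z.2.1⟩ z.2.2)
    (fun z => Subtype.ext (congrArg (Subtype.val : X → H) (R_eq ⟨z, hX z.2.1⟩ z.2.1)))
  refine ⟨e, fun h => ⟨hX h.2.1.1, ?_⟩⟩
  let w : ↥(X ⊓ LinearMap.ker d) := LinearMap.adjoint R' ⟨h, h.2.1⟩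
  have w_mem : (⟨w, w.2.1⟩ : X) ∈ K := w.2.2
  have proj_eq : K.starProjection (LinearMap.adjoint R ⟨h, hX h.2.1.1⟩) = ⟨w, w.2.1⟩ := by
    refine Submodule.eq_starProjection_of_mem_of_inner_eq_zero w_mem fun z hz => ?_
    rw [inner_sub_left, LinearMap.adjoint_inner_left, sub_eq_zero]
    exact (LinearMap.adjoint_inner_left R' ⟨z, z.2, hz⟩ ⟨h, h.2.1⟩).symm
  exact (he h).trans (congrArg Subtype.val proj_eq.symm)

end Harmonic

section Forms

variable {n k : ℕ}

theorem trace_trace {G F C : Finset (Eucl n)} (h : G ⊆ F) (h' : F ⊆ C) (ω : SmoothForm k C) :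
    trace k h (trace k h' ω) = trace k (h.trans h') ω := rfl

theorem trace_dForm {F C : Finset (Eucl n)} (h : F ⊆ C) (ω : SmoothForm k C) :
    trace (k + 1) h (dForm k C ω) = dForm k F (trace k h ω) := by
  obtain ⟨η, hη, hωη⟩ := ω.2
  exact Subtype.ext <| (congrArg (FormField.restrict h) (dForm_eq ω hη hωη)).trans
    (dForm_eq (trace k h ω) hη (congrArg (FormField.restrict h) hωη)).symm

theorem dForm_dForm {C : Finset (Eucl n)} (ω : SmoothForm k C) :
    dForm (k + 1) C (dForm k C ω) = 0 := by
  obtain ⟨η, hη, hωη⟩ := ω.2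
  have hsmooth : minSmoothness ℝ 2 ≤ ((⊤ : ℕ∞) : WithTop ℕ∞) := by
    rw [minSmoothness_of_isRCLikeNormedField]
    exact WithTop.coe_le_coe.2 (le_top : (2 : ℕ∞) ≤ ⊤)
  apply Subtype.ext
  rw [dForm_eq (dForm k C ω) (contDiff_extDeriv hη) (dForm_eq ω hη hωη),
    extDeriv_extDeriv hη hsmooth]
  rfl

theorem indicator_ne_zero {C : Finset (Eucl n)} (hC : C.Nonempty) : indicator C ≠ 0 := by
  obtain ⟨x, hx⟩ := hC
  intro h
  have h1 := congrFun (congrArg Subtype.val h) ⟨x, subset_convexHull ℝ _ (Finset.mem_coe.2 hx)⟩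
  exact one_ne_zero (congrArg (fun α : Dir C [⋀^Fin 0]→L[ℝ] ℝ => α fun i => i.elim0) h1)

theorem smoothForm_eq_zero (hk : n < k) {C : Finset (Eucl n)} (ω : SmoothForm k C) : ω = 0 := by
  have hrank : Module.finrank ℝ (Dir C) < Fintype.card (Fin k) := by
    rw [Fintype.card_fin]
    exact ((Submodule.finrank_le (Dir C)).trans_eq finrank_euclideanSpace_fin).trans_lt hk
  exact Subtype.ext <| funext fun x => ContinuousAlternatingMap.toAlternatingMap_injective <|
    alternatingMap_eq_zero_of_finrank_lt hrank _

end Forms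

namespace FEComplex

variable {n : ℕ} (A : FEComplex n)

section Incidence

theorem finrank_dir {m : ℕ} (C : Face A.T m) : Module.finrank ℝ (Dir C.1) = m := by
  have h := (A.T.indep C.2.1).finrank_vectorSpan (n := m) (by simpa using C.2.2)
  rwa [show Set.range (Subtype.val : C.1 → Eucl n) = C.1 from Subtype.range_coe] at h

theorem vsub_notMem_dir {C F : Finset (Eucl n)} (hC : C ∈ A.T.faces) (h : F ⊆ C) {p v : Eucl n}
    (hp : p ∈ F) (hv : v ∈ C) (hvF : v ∉ F) : p -ᵥ v ∉ Dir F := by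
  intro hmem
  have hv_span : v ∈ affineSpan ℝ (F : Set (Eucl n)) := by
    have := AffineSubspace.vadd_mem_of_mem_direction (s := affineSpan ℝ (F : Set (Eucl n)))
      (v := v -ᵥ p) (by rw [direction_affineSpan, ← neg_vsub_eq_vsub_rev]; exact neg_mem hmem)
      (subset_affineSpan ℝ _ (Finset.mem_coe.2 hp))
    simpa using this
  have hF : (Subtype.val '' {x : C | x.1 ∈ F}) = (F : Set (Eucl n)) := by
    ext x
    simpa using @h x
  rw [← hF] at hv_span
  exact hvF (((A.T.indep hC).mem_affineSpan_iff ⟨v, hv⟩ {x | x.1 ∈ F}).1 hv_span)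

variable {m : ℕ}

/-- The restriction to a face `F` of `C` of the contraction of `α` with `p - v`, as in
`InducesOrient`: for `v ∉ F`, the form on `F` that `α` induces, the outward vector first. -/
def contractFace {F C : Finset (Eucl n)} (h : F ⊆ C) {p v : Eucl n} (hp : p ∈ F) (hv : v ∈ C)
    (α : Dir C [⋀^Fin (m + 1)]→ₗ[ℝ] ℝ) : Dir F [⋀^Fin m]→ₗ[ℝ] ℝ :=
  (α.curryLeft (vec h hp hv)).compLinearMap
    (Submodule.inclusion (vectorSpan_mono ℝ (Finset.coe_subset.2 h)))

theorem contractFace_smul {F C : Finset (Eucl n)} (h : F ⊆ C) {p v : Eucl n} (hp : p ∈ F)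
    (hv : v ∈ C) (c : ℝ) (α : Dir C [⋀^Fin (m + 1)]→ₗ[ℝ] ℝ) :
    contractFace h hp hv (c • α) = c • contractFace h hp hv α := rfl

theorem contractFace_eq_of_mem {F C : Finset (Eucl n)} (h : F ⊆ C)
    (hF : Module.finrank ℝ (Dir F) ≤ m) {p p' v : Eucl n} (hp : p ∈ F) (hp' : p' ∈ F) (hv : v ∈ C)
    (α : Dir C [⋀^Fin (m + 1)]→ₗ[ℝ] ℝ) : contractFace h hp hv α = contractFace h hp' hv α := by
  let ι := Submodule.inclusion (vectorSpan_mono ℝ (Finset.coe_subset.2 h))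
  let u : Dir F := ⟨p -ᵥ p', vsub_mem_vectorSpan ℝ hp hp'⟩
  have vec_eq : vec h hp hv = vec h hp' hv + ι u :=
    Subtype.ext ((vsub_add_vsub_cancel p p' v).symm.trans (add_comm _ _))
  have contract_u : (α.curryLeft (ι u)).compLinearMap ι = 0 := by
    have restrict_eq_zero : α.compLinearMap ι = 0 :=
      alternatingMap_eq_zero_of_finrank_lt (hF.trans_lt (by simp)) _
    rw [← AlternatingMap.curryLeft_compLinearMap, restrict_eq_zero, AlternatingMap.curryLeft_zero,
      LinearMap.zero_apply]
  change (α.curryLeft (vec h hp hv)).compLinearMap ι = _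
  rw [vec_eq, map_add, AlternatingMap.add_compLinearMap, contract_u, add_zero]
  rfl

theorem contractFace_contractFace {G F C : Finset (Eucl n)} (hGF : G ⊆ F) (hFC : F ⊆ C)
    {p a b : Eucl n} (hp : p ∈ G) (ha : a ∈ F) (hb : b ∈ C) (α : Dir C [⋀^Fin (m + 2)]→ₗ[ℝ] ℝ) :
    contractFace hGF hp ha (contractFace hFC (hGF hp) hb α) =
      ((α.curryLeft (vec (hGF.trans hFC) hp hb)).curryLeft
        (vec (hGF.trans hFC) hp (hFC ha))).compLinearMap
          (Submodule.inclusion (vectorSpan_mono ℝ (Finset.coe_subset.2 (hGF.trans hFC)))) := by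
  rw [contractFace, contractFace, AlternatingMap.curryLeft_compLinearMap]
  rfl

theorem contractFace_contractFace_swap {G F F' C : Finset (Eucl n)} (hGF : G ⊆ F) (hGF' : G ⊆ F')
    (hFC : F ⊆ C) (hFC' : F' ⊆ C) {p a b : Eucl n} (hp : p ∈ G) (ha : a ∈ F) (hb : b ∈ F')
    (α : Dir C [⋀^Fin (m + 2)]→ₗ[ℝ] ℝ) :
    contractFace hGF hp ha (contractFace hFC (hGF hp) (hFC' hb) α) =
      -contractFace hGF' hp hb (contractFace hFC' (hGF' hp) (hFC ha) α) := by
  rw [contractFace_contractFace, contractFace_contractFace, curryLeft_curryLeft_swap]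
  rfl

theorem contractFace_orient_ne_zero (F : Face A.T m) (C : Face A.T (m + 1)) (h : F.1 ⊆ C.1)
    {p v : Eucl n} (hp : p ∈ F.1) (hv : v ∈ C.1) (hvF : v ∉ F.1) :
    contractFace h hp hv (A.orient (m + 1) C).someVector ≠ 0 := by
  let ι := Submodule.inclusion (vectorSpan_mono ℝ (Finset.coe_subset.2 h))
  let e := Module.finBasisOfFinrankEq ℝ (Dir F.1) (A.finrank_dir F)
  have vec_notMem : vec h hp hv ∉ Submodule.span ℝ (Set.range (ι ∘ e)) := fun hmem => by
    have span_le : Submodule.span ℝ (Set.range (ι ∘ e)) ≤ LinearMap.range ι :=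
      Submodule.span_le.2 (Set.range_comp_subset_range e ι)
    obtain ⟨y, hy⟩ := span_le hmem
    have hy' : (y : Eucl n) = p -ᵥ v := congrArg Subtype.val hy
    exact A.vsub_notMem_dir C.2.1 h hp hv hvF (hy' ▸ y.2)
  have indep : LinearIndependent ℝ (Fin.cons (vec h hp hv) (ι ∘ e) : Fin (m + 1) → Dir C.1) :=
    linearIndependent_finCons.2
      ⟨e.linearIndependent.map' ι (Submodule.ker_inclusion _ _ _), vec_notMem⟩
  let e' := basisOfLinearIndependentOfCardEqFinrank indep (by simpa using (A.finrank_dir C).symm)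
  have apply_ne : (A.orient (m + 1) C).someVector e' ≠ 0 :=
    (AlternatingMap.map_basis_ne_zero_iff e' _).2 (Module.Ray.someVector_ne_zero _)
  rw [coe_basisOfLinearIndependentOfCardEqFinrank] at apply_ne
  exact fun hzero => apply_ne (DFunLike.congr_fun hzero ⇑e)

theorem exists_contractFace_orient_eq_smul (F : Face A.T m) (C : Face A.T (m + 1))
    (h : F.1 ⊆ C.1) {p v : Eucl n} (hp : p ∈ F.1) (hv : v ∈ C.1) (hvF : v ∉ F.1) :
    ∃ l : ℝ, l ≠ 0 ∧
      contractFace h hp hv (A.orient (m + 1) C).someVector = l • (A.orient m F).someVector := by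
  obtain ⟨l, hl⟩ := exists_alternatingMap_eq_smul (A.finrank_dir F)
    (Module.Ray.someVector_ne_zero (A.orient m F))
    (contractFace h hp hv (A.orient (m + 1) C).someVector)
  refine ⟨l, ?_, hl⟩
  rintro rfl
  exact A.contractFace_orient_ne_zero F C h hp hv hvF (hl.trans (zero_smul ℝ _))

theorem opposite_vertex_unique {F : Face A.T m} {C : Face A.T (m + 1)} (h : F.1 ⊆ C.1)
    {v v' : Eucl n} (hv : v ∈ C.1) (hvF : v ∉ F.1) (hv' : v' ∈ C.1) (hvF' : v' ∉ F.1) :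
    v = v' := by
  classical
  have hcard : (C.1 \ F.1).card ≤ 1 := by
    rw [Finset.card_sdiff_of_subset h, C.2.2, F.2.2]; omega
  exact Finset.card_le_one.1 hcard v (by simp [hv, hvF]) v' (by simp [hv', hvF'])

theorem incidence_eq_sign (F : Face A.T m) (C : Face A.T (m + 1)) (h : F.1 ⊆ C.1)
    {p v : Eucl n} (hp : p ∈ F.1) (hv : v ∈ C.1) (hvF : v ∉ F.1) {l : ℝ} (hl : l ≠ 0)
    (hc : contractFace h hp hv (A.orient (m + 1) C).someVector = l • (A.orient m F).someVector) :
    A.incidence F C = SignType.sign l := by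
  have induces_iff : A.InducesOrient F C h ↔ 0 < l := by
    rw [← sameRay_smul_left_iff_of_ne (Module.Ray.someVector_ne_zero (A.orient m F)) hl, ← hc]
    constructor
    · rintro ⟨p', hp', v', hv', hvF', hs⟩
      obtain rfl := A.opposite_vertex_unique h hv hvF hv' hvF'
      rwa [contractFace_eq_of_mem h (A.finrank_dir F).le hp hp' hv]
    · exact fun hs => ⟨p, hp, v, hv, hvF, hs⟩
  rw [incidence, dif_pos h]
  rcases hl.lt_or_gt with hneg | hpos
  · rw [if_neg (mt induces_iff.1 hneg.not_gt), sign_neg hneg, SignType.coe_neg_one]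
  · rw [if_pos (induces_iff.2 hpos), sign_pos hpos, SignType.coe_one]

theorem incidence_of_not_subset {F : Face A.T m} {C : Face A.T (m + 1)} (h : ¬F.1 ⊆ C.1) :
    A.incidence F C = 0 := dif_neg h

theorem incidence_mul_incidence_add (G : Face A.T m) (F F' : Face A.T (m + 1))
    (C : Face A.T (m + 2)) (hF : F.1 ⊆ C.1) (hF' : F'.1 ⊆ C.1) (hG : G.1 ⊆ F.1) (hG' : G.1 ⊆ F'.1)
    (hne : F ≠ F') :
    A.incidence G F * A.incidence F C + A.incidence G F' * A.incidence F' C = 0 := by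
  have hcard : F.1.card = F'.1.card := F.2.2.trans F'.2.2.symm
  obtain ⟨a, haF, haF'⟩ := Finset.not_subset.1
    fun hs => hne (Subtype.ext (Finset.eq_of_subset_of_card_le hs hcard.ge))
  obtain ⟨b, hbF', hbF⟩ := Finset.not_subset.1
    fun hs => hne (Subtype.ext (Finset.eq_of_subset_of_card_le hs hcard.le)).symm
  obtain ⟨p, hp⟩ : G.1.Nonempty := Finset.card_pos.1 (by rw [G.2.2]; omega)
  have haG : a ∉ G.1 := fun h => haF' (hG' h)
  have hbG : b ∉ G.1 := fun h => hbF (hG h)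
  obtain ⟨l₁, hl₁, e₁⟩ := A.exists_contractFace_orient_eq_smul F C hF (hG hp) (hF' hbF') hbF
  obtain ⟨l₂, hl₂, e₂⟩ := A.exists_contractFace_orient_eq_smul G F hG hp haF haG
  obtain ⟨l₃, hl₃, e₃⟩ := A.exists_contractFace_orient_eq_smul F' C hF' (hG' hp) (hF haF) haF'
  obtain ⟨l₄, hl₄, e₄⟩ := A.exists_contractFace_orient_eq_smul G F' hG' hp hbF' hbG
  have hanti : l₂ * l₁ = -(l₄ * l₃) := by
    have swap := contractFace_contractFace_swap hG hG' hF hF' hp haF hbF'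
      (A.orient (m + 2) C).someVector
    rw [e₁, e₃, contractFace_smul, contractFace_smul, e₂, e₄, smul_smul, smul_smul, ← neg_smul]
      at swap
    linarith [smul_left_injective ℝ (Module.Ray.someVector_ne_zero (A.orient m G)) swap]
  have hsign : SignType.sign l₂ * SignType.sign l₁ = -(SignType.sign l₄ * SignType.sign l₃) := by
    rw [← sign_mul, ← sign_mul, hanti, Left.sign_neg]
  rw [A.incidence_eq_sign F C hF (hG hp) (hF' hbF') hbF hl₁ e₁,
    A.incidence_eq_sign G F hG hp haF haG hl₂ e₂,
    A.incidence_eq_sign F' C hF' (hG' hp) (hF haF) haF' hl₃ e₃,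
    A.incidence_eq_sign G F' hG' hp hbF' hbG hl₄ e₄, add_eq_zero_iff_eq_neg]
  exact_mod_cast congrArg (fun s : SignType => (s : ℝ)) hsign

variable {A} in
open Classical in
theorem exists_cell_insert {j : ℕ} {G : A.Cell m} {C : A.Cell j} (hGC : G.1.1 ⊆ C.1.1) {x : Eucl n}
    (hxC : x ∈ C.1.1) (hxG : x ∉ G.1.1) : ∃ F : A.Cell (m + 1), F.1.1 = insert x G.1.1 := by
  have hG : G.1.1.Nonempty := Finset.card_pos.1 (by rw [G.1.2.2]; omega)
  have hF : insert x G.1.1 ∈ A.T.faces :=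
    A.T.down_closed C.1.2.1 (Finset.insert_subset hxC hGC) (Finset.insert_nonempty _ _)
  exact ⟨⟨⟨insert x G.1.1, hF, by rw [Finset.card_insert_of_notMem hxG, G.1.2.2]⟩, hF,
    fun hU => G.2.2 (A.U.down_closed hU (Finset.subset_insert _ _) hG)⟩, rfl⟩

open Classical in
theorem sum_incidence_mul_incidence (G : A.Cell m) (C : A.Cell (m + 2)) :
    ∑ F : A.Cell (m + 1), A.incidence G.1 F.1 * A.incidence F.1 C.1 = 0 := by
  have summand_eq_zero (F : A.Cell (m + 1)) (h : ¬(G.1.1 ⊆ F.1.1 ∧ F.1.1 ⊆ C.1.1)) :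
      A.incidence G.1 F.1 * A.incidence F.1 C.1 = 0 := by
    rcases not_and_or.1 h with h | h
    · rw [A.incidence_of_not_subset h, zero_mul]
    · rw [A.incidence_of_not_subset h, mul_zero]
  by_cases hGC : G.1.1 ⊆ C.1.1
  swap
  · exact Finset.sum_eq_zero fun F _ => summand_eq_zero F fun h => hGC (h.1.trans h.2)
  obtain ⟨a, b, hab, hCG⟩ : ∃ a b, a ≠ b ∧ C.1.1 \ G.1.1 = {a, b} := Finset.card_eq_two.1 (by
    rw [Finset.card_sdiff_of_subset hGC, C.1.2.2, G.1.2.2]; omega)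
  obtain ⟨haC, haG⟩ : a ∈ C.1.1 ∧ a ∉ G.1.1 := Finset.mem_sdiff.1 (by simp [hCG])
  obtain ⟨hbC, hbG⟩ : b ∈ C.1.1 ∧ b ∉ G.1.1 := Finset.mem_sdiff.1 (by simp [hCG])
  obtain ⟨Fa, hFa⟩ := exists_cell_insert hGC haC haG
  obtain ⟨Fb, hFb⟩ := exists_cell_insert hGC hbC hbG
  have hne : Fa ≠ Fb := by
    rintro rfl
    have : a ∈ insert b G.1.1 := hFb ▸ hFa ▸ Finset.mem_insert_self a _
    simp [hab, haG] at this
  rw [Finset.sum_eq_add Fa Fb hne ?_ (by simp) (by simp)]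
  · exact A.incidence_mul_incidence_add G.1 Fa.1 Fb.1 C.1
      (hFa ▸ Finset.insert_subset haC hGC) (hFb ▸ Finset.insert_subset hbC hGC)
      (hFa ▸ Finset.subset_insert _ _) (hFb ▸ Finset.subset_insert _ _)
      (Subtype.coe_injective.ne hne)
  · rintro F - ⟨hFa', hFb'⟩
    refine summand_eq_zero F fun ⟨hGF, hFC⟩ => ?_
    obtain ⟨x, hxG, hx⟩ : ∃ x ∉ G.1.1, insert x G.1.1 = F.1.1 :=
      (Finset.covBy_iff_exists_insert).1 ((Finset.covBy_iff_card_sdiff_eq_one).2 ⟨hGF, by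
        rw [Finset.card_sdiff_of_subset hGF, F.1.2.2, G.1.2.2]; omega⟩)
    have hxab : x ∈ ({a, b} : Finset (Eucl n)) := by
      rw [← hCG, Finset.mem_sdiff]
      exact ⟨hFC (hx ▸ Finset.mem_insert_self x _), hxG⟩
    rcases Finset.mem_insert.1 hxab with rfl | hxb
    · exact hFa' (Subtype.ext (Subtype.ext (hx.symm.trans hFa.symm)))
    · rw [Finset.mem_singleton.1 hxb] at hx
      exact hFb' (Subtype.ext (Subtype.ext (hx.symm.trans hFb.symm)))

end Incidence

theorem card_le {C : Finset (Eucl n)} (hC : C ∈ A.T.faces) : C.card ≤ n + 1 := by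
  obtain ⟨C', _, h, hcard⟩ := A.exists_supersimplex C hC
  exact hcard ▸ Finset.card_le_card h

section Differentials

variable {A} {k m : ℕ}

theorem trace_Tv (ω : A.Broken k (m + 1)) (F : A.Cell m) {H : Finset (Eucl n)} (hH : H ⊆ F.1.1)
    {g : A.Cell (m + 1) → SmoothForm k H}
    (hg : ∀ C, ∀ h : H ⊆ C.1.1, trace k h (ω C : SmoothForm k C.1.1) = g C) :
    trace k hH (A.Tv k m ω F : SmoothForm k F.1.1) = ∑ C, A.incidence F.1 C.1 • g C := by
  classical
  change trace k hH ((∑ C : A.Cell (m + 1), _ : A.space k F.1.1) : SmoothForm k F.1.1) = _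
  rw [AddSubmonoidClass.coe_finsetSum, map_sum]
  refine Finset.sum_congr rfl fun C _ => ?_
  by_cases hC : F.1.1 ⊆ C.1.1
  · rw [dif_pos hC, ← hg C (hH.trans hC)]
    rfl
  · rw [dif_neg hC, A.incidence_of_not_subset hC, zero_smul]
    rfl

theorem coe_Tv (ω : A.Broken k (m + 1)) (F : A.Cell m) {g : A.Cell (m + 1) → SmoothForm k F.1.1}
    (hg : ∀ C, ∀ h : F.1.1 ⊆ C.1.1, trace k h (ω C : SmoothForm k C.1.1) = g C) :
    (A.Tv k m ω F : SmoothForm k F.1.1) = ∑ C, A.incidence F.1 C.1 • g C :=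
  trace_Tv ω F subset_rfl hg

theorem exists_forall_trace_eq (ω : A.Broken k m) (H : Finset (Eucl n)) :
    ∃ g : A.Cell m → SmoothForm k H,
      ∀ C, ∀ h : H ⊆ C.1.1, trace k h (ω C : SmoothForm k C.1.1) = g C := by
  classical
  exact ⟨fun C => if h : H ⊆ C.1.1 then trace k h (ω C : SmoothForm k C.1.1) else 0,
    fun C h => by simp only [dif_pos h]⟩

theorem Tv_Tv (ω : A.Broken k (m + 2)) : A.Tv k m (A.Tv k (m + 1) ω) = 0 := by
  funext G
  obtain ⟨g, hg⟩ := exists_forall_trace_eq ω G.1.1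
  apply Subtype.ext
  rw [coe_Tv _ G fun F hF => trace_Tv ω F hF hg]
  simp only [Finset.smul_sum, smul_smul]
  rw [Finset.sum_comm]
  refine Finset.sum_eq_zero fun C _ => ?_
  rw [← Finset.sum_smul, A.sum_incidence_mul_incidence, zero_smul]

theorem D_D (ω : A.Broken k m) : A.D (k + 1) m (A.D k m ω) = 0 :=
  funext fun _ => Subtype.ext (dForm_dForm _)

theorem D_Tv (ω : A.Broken k (m + 1)) :
    A.D k m (A.Tv k m ω) = A.Tv (k + 1) m (A.D k (m + 1) ω) := by
  funext F
  obtain ⟨g, hg⟩ := exists_forall_trace_eq ω F.1.1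
  apply Subtype.ext
  change dForm k F.1.1 (A.Tv k m ω F : SmoothForm k F.1.1) = _
  rw [coe_Tv ω F hg, coe_Tv (A.D k (m + 1) ω) F fun C h =>
    (trace_dForm h _).trans (congrArg (dForm k F.1.1) (hg C h))]
  simp only [map_sum, map_smul]

variable (A) in
/-- The kernel of the vertical differential `𝖳` on `Λ_{-1}^k(𝒯^m)`. It is the whole space for
`m = 0`, where the target `Λ_{-1}^k(𝒯^{-1})` vanishes. -/
def vertKer (k : ℕ) : (m : ℕ) → Submodule ℝ (A.Broken k m)
  | 0 => ⊤
  | m + 1 => LinearMap.ker (A.Tv k m)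

theorem Tv_mem_vertKer (ω : A.Broken k (m + 1)) : A.Tv k m ω ∈ A.vertKer k m := by
  cases m with
  | zero => trivial
  | succ m => exact Tv_Tv ω

theorem exists_D_eq (hexact : A.LocalExactness) (ω : A.Broken (k + 1) m)
    (hω : A.D (k + 1) m ω = 0) : ∃ η, A.D k m η = ω := by
  have hcell : ∀ C : A.Cell m, ∃ η : A.space k C.1.1, A.dd k C.1.2.1 η = ω C := fun C => by
    obtain ⟨η, hη, hηω⟩ := (hexact C.1.1 C.1.2.1 C.2.2).2 k (ω C) (ω C).2
      (congrArg Subtype.val (congrFun hω C))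
    exact ⟨⟨η, hη⟩, Subtype.ext hηω⟩
  choose η hη using hcell
  exact ⟨η, funext hη⟩

end Differentials

section VerticalExactness

theorem sum_relFace_congr {V : Type*} [AddCommMonoid V] {K L K' L' : Set (Finset (Eucl n))} {m : ℕ}
    {f : Face A.T m → V}
    (h : ∀ C, f C ≠ 0 → (C.1 ∈ K ∧ C.1 ∉ L ↔ C.1 ∈ K' ∧ C.1 ∉ L')) :
    ∑ C : A.RelFace K L m, f C.1 = ∑ C : A.RelFace K' L' m, f C.1 := by
  rw [← finsum_eq_sum_of_fintype, ← finsum_eq_sum_of_fintype,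
    finsum_subtype_eq_finsum_cond (f := f) fun C : Face A.T m => C.1 ∈ K ∧ C.1 ∉ L,
    finsum_subtype_eq_finsum_cond (f := f) fun C : Face A.T m => C.1 ∈ K' ∧ C.1 ∉ L']
  refine finsum_congr fun C => ?_
  by_cases hC : f C = 0
  · simp only [hC, finsum_zero]
  · rw [h C hC]

variable {A} {k m : ℕ} {F : Finset (Eucl n)}

theorem mem_patch_of_subset {C : Finset (Eucl n)} (hC : C ∈ A.T.faces) (h : F ⊆ C) :
    C ∈ A.patch F := by
  obtain ⟨C', hC', hs, hcard⟩ := A.exists_supersimplex C hC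
  exact ⟨hC, C', hC', hcard, h.trans hs, hs⟩

theorem relFace_patch_iff (hm : m < n) {C : Face A.T m} :
    C.1 ∈ A.patch F ∧ C.1 ∉ A.patchBdry F ↔ F ⊆ C.1 ∧ C.1 ∉ A.U.faces := by
  have hcard : C.1.card ≤ n := C.2.2.trans_le hm
  refine ⟨fun ⟨hp, hb⟩ => ?_, fun ⟨hF, hU⟩ =>
    ⟨mem_patch_of_subset C.2.1 hF, fun hb => hb.2.2.elim (· hF) hU⟩⟩
  by_contra h
  exact hb ⟨hp, hcard, or_iff_not_imp_left.2 fun hF => by_contra fun hU => h ⟨not_not.1 hF, hU⟩⟩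

theorem sum_incidence_patch {V : Type*} [AddCommGroup V] [Module ℝ V] (C : A.Cell m)
    (h : F ⊆ C.1.1) (g : Face A.T (m + 1) → V) :
    ∑ C' : A.RelFace (A.patch F) (A.patchBdry F) (m + 1), A.incidence C.1 C'.1 • g C'.1 =
      ∑ C' : A.Cell (m + 1), A.incidence C.1 C'.1 • g C'.1 := by
  refine A.sum_relFace_congr (f := fun C' => A.incidence C.1 C' • g C') fun C' hC' => ?_
  have hCC' : C.1.1 ⊆ C'.1 := by
    by_contra hs
    exact hC' (by rw [A.incidence_of_not_subset hs, zero_smul])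
  have hU : C'.1 ∉ A.U.faces := fun hU =>
    C.2.2 (A.U.down_closed hU hCC' (Finset.card_pos.1 (by rw [C.1.2.2]; omega)))
  exact iff_of_true ⟨mem_patch_of_subset C'.2.1 (h.trans hCC'),
    fun hb => hb.2.2.elim (· (h.trans hCC')) hU⟩ ⟨C'.2.1, hU⟩

theorem exists_bdry_eq_of_localPatch (hpatch : A.LocalPatch) (hF : F ∈ A.T.faces) (hm : m < n)
    {c : A.Chain (A.patch F) (A.patchBdry F) m}
    (hc : c ∈ A.cycles (A.patch F) (A.patchBdry F) m) :
    ∃ u, A.bdry (A.patch F) (A.patchBdry F) m u = c := by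
  have h := hpatch F hF m hm
  rw [Submodule.Quotient.subsingleton_iff, Submodule.submoduleOf_eq_top] at h
  exact h hc

variable (A) in
/-- The traces of `ω` to all faces with fewer than `j` vertices vanish: the invariant of the
induction on skeleta that solves `𝖳 η = ω`. -/
def TraceVanishes (ω : A.Broken k m) (j : ℕ) : Prop :=
  ∀ C, ∀ G ∈ A.T.faces, ∀ h : G ⊆ C.1.1, G.card < j → trace k h (ω C : SmoothForm k C.1.1) = 0

theorem trace_mem_bubble (hF : F ∈ A.T.faces) {ω : A.Broken k m}
    (hω : A.TraceVanishes ω F.card) (C : A.Cell m) (h : F ⊆ C.1.1) :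
    trace k h (ω C : SmoothForm k C.1.1) ∈ A.bubble k F := by
  have hspace : trace k h (ω C : SmoothForm k C.1.1) ∈ A.space k F :=
    A.map_trace k C.1.1 C.1.2.1 F hF h ▸ Submodule.mem_map_of_mem (ω C).2
  refine ⟨hspace, ?_⟩
  simp only [SetLike.mem_coe, Submodule.mem_iInf, LinearMap.mem_ker]
  intro G hG hGF
  rw [trace_trace]
  exact hω C G hG (hGF.subset.trans h) (Finset.card_lt_card hGF)

theorem exists_bubble_eq_trace (hF : F ∈ A.T.faces) {ω : A.Broken k m}
    (hω : A.TraceVanishes ω F.card) :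
    ∃ g : Face A.T m → A.bubble k F, ∀ C : A.Cell m, ∀ h : F ⊆ C.1.1,
      (g C.1 : SmoothForm k F) = trace k h (ω C : SmoothForm k C.1.1) := by
  classical
  exact ⟨fun C => if h : F ⊆ C.1 ∧ C.1 ∉ A.U.faces then
      ⟨_, trace_mem_bubble hF hω ⟨C, C.2.1, h.2⟩ h.1⟩ else 0,
    fun C h => by simp only [dif_pos (And.intro h C.2.2)]⟩

theorem bubble_trace_mem_cycles (hm : m < n) {ω : A.Broken k m} (hω : ω ∈ A.vertKer k m)
    {g : Face A.T m → A.bubble k F}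
    (hg : ∀ C : A.Cell m, ∀ h : F ⊆ C.1.1,
      (g C.1 : SmoothForm k F) = trace k h (ω C : SmoothForm k C.1.1))
    (φ : Module.Dual ℝ (A.bubble k F)) :
    (fun C => φ (g C.1)) ∈ A.cycles (A.patch F) (A.patchBdry F) m := by
  cases m with
  | zero => trivial
  | succ m =>
    funext G
    obtain ⟨hG, hGU⟩ := (relFace_patch_iff (by omega)).1 G.2
    let G' : A.Cell m := ⟨G.1, G.1.2.1, hGU⟩
    have hsum : ∑ C : A.Cell (m + 1), A.incidence G.1 C.1 • g C.1 = 0 := by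
      apply Subtype.ext
      rw [AddSubmonoidClass.coe_finsetSum]
      refine (trace_Tv ω G' hG fun C h => (hg C h).symm).symm.trans ?_
      rw [show A.Tv k m ω = 0 from hω]
      rfl
    rw [← sum_incidence_patch G' hG g] at hsum
    change ∑ C : A.RelFace _ _ (m + 1), A.incidence G.1 C.1 * φ (g C.1) = 0
    simpa only [map_sum, map_smul, smul_eq_mul, map_zero] using congrArg φ hsum

theorem exists_bubble_filling (hpatch : A.LocalPatch) (hF : F ∈ A.T.faces) (hm : m < n)
    {ω : A.Broken k m} (hω : ω ∈ A.vertKer k m) (h0 : A.TraceVanishes ω F.card) :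
    ∃ u : Face A.T (m + 1) → A.bubble k F, ∀ C : A.Cell m, ∀ h : F ⊆ C.1.1,
      ∑ C' : A.Cell (m + 1), A.incidence C.1 C'.1 • (u C'.1 : SmoothForm k F) =
        trace k h (ω C : SmoothForm k C.1.1) := by
  classical
  have := A.finiteDimensional k F hF
  have : FiniteDimensional ℝ (A.bubble k F) :=
    Submodule.finiteDimensional_of_le (S₂ := A.space k F) inf_le_left
  obtain ⟨g, hg⟩ := exists_bubble_eq_trace hF h0
  obtain ⟨u, hu⟩ := exists_sum_smul_eq_of_forall_dual
    (fun (C : A.RelFace (A.patch F) (A.patchBdry F) m)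
      (C' : A.RelFace (A.patch F) (A.patchBdry F) (m + 1)) => A.incidence C.1 C'.1)
    (fun C => g C.1) fun φ =>
      let ⟨u, hu⟩ := exists_bdry_eq_of_localPatch hpatch hF hm (bubble_trace_mem_cycles hm hω hg φ)
      ⟨u, congrFun hu⟩
  let u' : Face A.T (m + 1) → A.bubble k F := fun C' =>
    if h : C'.1 ∈ A.patch F ∧ C'.1 ∉ A.patchBdry F then u ⟨C', h⟩ else 0
  refine ⟨u', fun C h => ?_⟩
  have hsum : ∑ C' : A.Cell (m + 1), A.incidence C.1 C'.1 • u' C'.1 = g C.1 := by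
    rw [← sum_incidence_patch C h u', ← hu ⟨C.1, (relFace_patch_iff hm).2 ⟨h, C.2.2⟩⟩]
    exact Finset.sum_congr rfl fun C' _ => by simp only [u', dif_pos C'.2]
  rw [← hg C h, ← hsum, AddSubmonoidClass.coe_finsetSum]
  rfl

theorem exists_trace_eq_bubble (hgeom : A.GeometricDecomposition) (j : ℕ)
    (u : ∀ F : Finset (Eucl n), Face A.T m → A.bubble k F) :
    ∃ ζ : A.Broken k m, ∀ C : A.Cell m, ∀ H ∈ A.T.faces, ∀ h : H ⊆ C.1.1, H.card ≤ j →
      trace k h (ζ C : SmoothForm k C.1.1) =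
        if H.card = j then (u H C.1 : SmoothForm k H) else 0 := by
  classical
  obtain ⟨ext, hext⟩ := hgeom
  let faces : A.Cell m → Finset (Finset (Eucl n)) := fun C =>
    A.finite_faces.toFinset.filter fun F => F.card = j ∧ F ⊆ C.1.1
  have mem_faces : ∀ {C : A.Cell m} {F}, F ∈ faces C ↔
      F ∈ A.T.faces ∧ F.card = j ∧ F ⊆ C.1.1 := by
    simp [faces]
  have hmem : ∀ C : A.Cell m, ∑ F ∈ faces C, ext k F C.1.1 (u F C.1) ∈ A.space k C.1.1 :=
    fun C => Submodule.sum_mem _ fun F hF =>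
      have ⟨hFT, _, hFC⟩ := mem_faces.1 hF
      (hext k F hFT C.1.1 C.1.2.1 hFC _).1
  refine ⟨fun C => ⟨_, hmem C⟩, fun C H hH h hj => ?_⟩
  have hother : ∀ F ∈ faces C, F ≠ H → trace k h (ext k F C.1.1 (u F C.1)) = 0 := fun F hF hne => by
    obtain ⟨hFT, hFj, hFC⟩ := mem_faces.1 hF
    exact ((hext k F hFT C.1.1 C.1.2.1 hFC _).2.2 H hH h).2 fun hs =>
      hne (Finset.eq_of_subset_of_card_le hs (hFj ▸ hj))
  change trace k h (∑ F ∈ faces C, ext k F C.1.1 (u F C.1)) = _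
  rw [map_sum]
  split_ifs with hHj
  · rw [Finset.sum_eq_single_of_mem H (mem_faces.2 ⟨hH, hHj, h⟩) hother]
    exact (hext k H hH C.1.1 C.1.2.1 h _).2.1
  · exact Finset.sum_eq_zero fun F hF => hother F hF fun hFH =>
      hHj (hFH ▸ (mem_faces.1 hF).2.1)

theorem exists_traceVanishes_sub_Tv_succ (hgeom : A.GeometricDecomposition)
    (hpatch : A.LocalPatch) (hm : m < n) {j : ℕ} {ω : A.Broken k m} (hω : ω ∈ A.vertKer k m)
    (h0 : A.TraceVanishes ω j) :
    ∃ ζ : A.Broken k (m + 1), A.TraceVanishes (ω - A.Tv k m ζ) (j + 1) := by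
  have hfill : ∀ F : Finset (Eucl n), ∃ u : Face A.T (m + 1) → A.bubble k F,
      F ∈ A.T.faces → F.card = j → ∀ C : A.Cell m, ∀ h : F ⊆ C.1.1,
      ∑ C' : A.Cell (m + 1), A.incidence C.1 C'.1 • (u C'.1 : SmoothForm k F) =
        trace k h (ω C : SmoothForm k C.1.1) := fun F => by
    by_cases hF : F ∈ A.T.faces ∧ F.card = j
    · obtain ⟨u, hu⟩ := exists_bubble_filling hpatch hF.1 hm hω (hF.2 ▸ h0)
      exact ⟨u, fun _ _ => hu⟩
    · exact ⟨0, fun hFT hFj => absurd ⟨hFT, hFj⟩ hF⟩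
  choose u hu using hfill
  obtain ⟨ζ, hζ⟩ := exists_trace_eq_bubble hgeom j u
  refine ⟨ζ, fun C G hG h hGj => ?_⟩
  change trace k h ((ω C : SmoothForm k C.1.1) - (A.Tv k m ζ C : SmoothForm k C.1.1)) = 0
  rw [map_sub, trace_Tv ζ C h fun C' h' => hζ C' G hG h' (by omega)]
  split_ifs with hcard
  · rw [hu G hG hcard C h, sub_self]
  · simp [h0 C G hG h (by omega)]

theorem exists_traceVanishes_sub_Tv (hgeom : A.GeometricDecomposition) (hpatch : A.LocalPatch)
    (hm : m < n) {ω : A.Broken k m} (hω : ω ∈ A.vertKer k m) (j : ℕ) :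
    ∃ η : A.Broken k (m + 1), A.TraceVanishes (ω - A.Tv k m η) j := by
  induction j with
  | zero => exact ⟨0, fun _ _ _ _ h => absurd h (Nat.not_lt_zero _)⟩
  | succ j ih =>
    obtain ⟨η, hη⟩ := ih
    obtain ⟨ζ, hζ⟩ := exists_traceVanishes_sub_Tv_succ hgeom hpatch hm
      (Submodule.sub_mem _ hω (Tv_mem_vertKer η)) hη
    exact ⟨η + ζ, by rwa [map_add, ← sub_sub]⟩

theorem exists_Tv_eq (hgeom : A.GeometricDecomposition) (hpatch : A.LocalPatch) (hm : m < n)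
    {ω : A.Broken k m} (hω : ω ∈ A.vertKer k m) : ∃ η, A.Tv k m η = ω := by
  obtain ⟨η, hη⟩ := exists_traceVanishes_sub_Tv hgeom hpatch hm hω (m + 2)
  refine ⟨η, (sub_eq_zero.1 (funext fun C => Subtype.ext ?_)).symm⟩
  exact hη C C.1.1 C.1.2.1 subset_rfl (by rw [C.1.2.2]; omega)

end VerticalExactness

section Coefficients

theorem subsingleton_broken {k m : ℕ} (h : ¬(k ≤ n ∧ m ≤ n)) : Subsingleton (A.Broken k m) := by
  refine ⟨fun ω ω' => funext fun C => ?_⟩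
  have hm : m ≤ n := by
    have hcard := A.card_le C.1.2.1
    rw [C.1.2.2] at hcard
    omega
  have hk : n < k := not_le.1 fun hk => h ⟨hk, hm⟩
  exact Subtype.ext ((smoothForm_eq_zero hk _).trans (smoothForm_eq_zero hk _).symm)

variable (S : A.ScalarProducts)

/-- The component of `ω` in `Λ_{-1}^k(𝒯^m)`, as an element of that space; in contrast, `component`
returns it as an element of the direct sum. For `k > n` or `m > n`, where `Total` has no such
summand, `Λ_{-1}^k(𝒯^m)` vanishes, so that the formulas below need no bounds on `k` and `m`. -/
def coeff (k m : ℕ) : A.Total S →ₗ[ℝ] A.Broken k m where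
  toFun ω := if h : k < n + 1 ∧ m < n + 1 then
    (A.toH S k m).symm (ω (⟨k, h.1⟩, ⟨m, h.2⟩)) else 0
  map_add' ω ω' := by split_ifs <;> simp
  map_smul' c ω := by split_ifs <;> simp

variable {A S}

theorem coeff_apply (ω : A.Total S) (p : Fin (n + 1) × Fin (n + 1)) :
    A.coeff S p.1 p.2 ω = (A.toH S p.1 p.2).symm (ω p) :=
  dif_pos ⟨p.1.2, p.2.2⟩

theorem eq_of_forall_lt {k m : ℕ} {x y : A.Broken k m} (h : k < n + 1 → m < n + 1 → x = y) :
    x = y := by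
  by_cases hkm : k ≤ n ∧ m ≤ n
  · exact h (Nat.lt_succ_of_le hkm.1) (Nat.lt_succ_of_le hkm.2)
  · have := A.subsingleton_broken hkm
    exact Subsingleton.elim x y

theorem total_ext {ω ω' : A.Total S} (h : ∀ k m, A.coeff S k m ω = A.coeff S k m ω') :
    ω = ω' := by
  ext p : 1
  have hp := h p.1 p.2
  rwa [coeff_apply, coeff_apply, (A.toH S _ _).symm.injective.eq_iff] at hp

theorem mem_supported {I : Set (ℕ × ℕ)} {ω : A.Total S} :
    ω ∈ A.supported S I ↔ ∀ k m, (k, m) ∉ I → A.coeff S k m ω = 0 := by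
  refine ⟨fun h k m hkm => eq_of_forall_lt fun hk hm => ?_, fun h p hp => ?_⟩
  · rw [coeff_apply ω (⟨k, hk⟩, ⟨m, hm⟩), h _ hkm, map_zero]
  · have hcoeff := h _ _ hp
    rwa [coeff_apply, LinearEquiv.map_eq_zero_iff] at hcoeff

theorem coeff_DD_zero (m : ℕ) (ω : A.Total S) : A.coeff S 0 m (A.DD S ω) = 0 :=
  eq_of_forall_lt fun hk hm => coeff_apply _ (⟨0, hk⟩, ⟨m, hm⟩)

theorem coeff_DD_succ (k m : ℕ) (ω : A.Total S) :
    A.coeff S (k + 1) m (A.DD S ω) = A.D k m (A.coeff S k m ω) :=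
  eq_of_forall_lt fun hk hm => by
    rw [coeff_apply _ (⟨k + 1, hk⟩, ⟨m, hm⟩), coeff_apply _ (⟨k, by omega⟩, ⟨m, hm⟩)]
    rfl

theorem coeff_TT (k m : ℕ) (ω : A.Total S) :
    A.coeff S k m (A.TT S ω) = A.Tv k m (A.coeff S k (m + 1) ω) :=
  eq_of_forall_lt fun hk hm => by
    rw [coeff_apply _ (⟨k, hk⟩, ⟨m, hm⟩)]
    by_cases h : m < n
    · rw [coeff_apply _ (⟨k, hk⟩, ⟨m + 1, by omega⟩)]
      exact congrArg (A.toH S k m).symm (dif_pos h)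
    · have := A.subsingleton_broken (k := k) (m := m + 1) (by omega)
      rw [Subsingleton.elim (A.coeff S k (m + 1) ω) 0, map_zero]
      exact congrArg (A.toH S k m).symm (dif_neg h)

theorem coeff_EE_succ (E : A.VertOps) (k m : ℕ) (ω : A.Total S) :
    A.coeff S k (m + 1) (A.EE S E ω) = E k m (A.coeff S k m ω) :=
  eq_of_forall_lt fun hk hm => by
    rw [coeff_apply _ (⟨k, hk⟩, ⟨m + 1, hm⟩), coeff_apply _ (⟨k, hk⟩, ⟨m, by omega⟩)]
    rfl

theorem coeff_PP (P : A.HorizOps) (k m : ℕ) (ω : A.Total S) :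
    A.coeff S k m (A.PP S P ω) = P k m (A.coeff S (k + 1) m ω) :=
  eq_of_forall_lt fun hk hm => by
    rw [coeff_apply _ (⟨k, hk⟩, ⟨m, hm⟩)]
    by_cases h : k < n
    · rw [coeff_apply _ (⟨k + 1, by omega⟩, ⟨m, hm⟩)]
      exact congrArg (A.toH S k m).symm (dif_pos h)
    · have := A.subsingleton_broken (k := k + 1) (m := m) (by omega)
      rw [Subsingleton.elim (A.coeff S (k + 1) m ω) 0, map_zero]
      exact congrArg (A.toH S k m).symm (dif_neg h)

theorem coeff_sgn (k m : ℕ) (ω : A.Total S) :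
    A.coeff S k m (A.sgn S ω) = (-1 : ℝ) ^ (n - m) • A.coeff S k m ω :=
  eq_of_forall_lt fun hk hm => by
    rw [coeff_apply _ (⟨k, hk⟩, ⟨m, hm⟩), coeff_apply _ (⟨k, hk⟩, ⟨m, hm⟩), ← map_smul]
    rfl

theorem coeff_component (k m k' m' : ℕ) (ω : A.Total S) :
    A.coeff S k m (A.component S k' m' ω) =
      if k = k' ∧ m = m' then A.coeff S k m ω else 0 :=
  eq_of_forall_lt fun hk hm => by
    rw [coeff_apply _ (⟨k, hk⟩, ⟨m, hm⟩), coeff_apply _ (⟨k, hk⟩, ⟨m, hm⟩)]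
    change (A.toH S k m).symm (if k = k' ∧ m = m' then _ else _) = _
    split_ifs <;> rfl

variable (A S) in
/-- The identification of `Λ_{-1}^k(𝒯^m)`, as a summand of the direct sum, with the space
itself. -/
def coeffEquiv (k m : ℕ) : A.supported S {(k, m)} ≃ₗ[ℝ] A.Broken k m :=
  LinearEquiv.ofBijective ((A.coeff S k m).domRestrict _) <| by
    refine ⟨fun ω ω' h => Subtype.ext (total_ext fun k' m' => ?_), fun x => ?_⟩
    · by_cases hkm : (k', m') = (k, m)
      · obtain ⟨rfl, rfl⟩ := Prod.mk.inj hkm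
        exact h
      · rw [mem_supported.1 ω.2 k' m' hkm, mem_supported.1 ω'.2 k' m' hkm]
    · by_cases hkm : k ≤ n ∧ m ≤ n
      · let p : Fin (n + 1) × Fin (n + 1) :=
          (⟨k, Nat.lt_succ_of_le hkm.1⟩, ⟨m, Nat.lt_succ_of_le hkm.2⟩)
        let ω : A.Total S := WithLp.toLp 2 (Pi.single p (A.toH S k m x))
        have hω : ω ∈ A.supported S {(k, m)} := fun q hq =>
          Pi.single_eq_of_ne (M := fun p : Fin (n + 1) × Fin (n + 1) => A.HBroken S p.1 p.2)
            (fun hqp => hq (by rw [hqp]; rfl)) _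
        refine ⟨⟨ω, hω⟩, (coeff_apply ω p).trans (congrArg (A.toH S k m).symm ?_)⟩
        exact Pi.single_eq_same
          (M := fun p : Fin (n + 1) × Fin (n + 1) => A.HBroken S p.1 p.2) p (A.toH S k m x)
      · have := A.subsingleton_broken hkm
        exact ⟨0, Subsingleton.elim _ _⟩

theorem eq_of_mem_supported_singleton {k m : ℕ} {ω ω' : A.Total S}
    (hω : ω ∈ A.supported S {(k, m)}) (hω' : ω' ∈ A.supported S {(k, m)})
    (h : A.coeff S k m ω = A.coeff S k m ω') : ω = ω' :=
  congrArg Subtype.val ((A.coeffEquiv S k m).injective (a₁ := ⟨ω, hω⟩) (a₂ := ⟨ω', hω'⟩) h)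

theorem coeff_coeffEquiv_symm {k m : ℕ} (x : A.Broken k m) :
    A.coeff S k m ((A.coeffEquiv S k m).symm x) = x :=
  (A.coeffEquiv S k m).apply_symm_apply x

theorem component_of_mem {k m : ℕ} {ω : A.Total S} (h : ω ∈ A.supported S {(k, m)}) :
    A.component S k m ω = ω :=
  eq_of_mem_supported_singleton (A.component_mem S k m ω) h (by
    rw [coeff_component, if_pos ⟨rfl, rfl⟩])

end Coefficients

section Differentials

variable {A} {S : A.ScalarProducts}

theorem DD_DD (ω : A.Total S) : A.DD S (A.DD S ω) = 0 :=
  total_ext fun k m => by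
    rcases k with _ | _ | k
    · rw [coeff_DD_zero, map_zero]
    · rw [coeff_DD_succ, coeff_DD_zero, map_zero, map_zero]
    · rw [coeff_DD_succ, coeff_DD_succ, D_D, map_zero]

theorem TT_TT (ω : A.Total S) : A.TT S (A.TT S ω) = 0 :=
  total_ext fun k m => by rw [coeff_TT, coeff_TT, Tv_Tv, map_zero]

theorem DD_TT (ω : A.Total S) : A.DD S (A.TT S ω) = A.TT S (A.DD S ω) :=
  total_ext fun k m => by
    cases k with
    | zero => rw [coeff_DD_zero, coeff_TT, coeff_DD_zero, map_zero]
    | succ k => rw [coeff_DD_succ, coeff_TT, coeff_TT, coeff_DD_succ, D_Tv]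

theorem sgn_sgn (ω : A.Total S) : A.sgn S (A.sgn S ω) = ω :=
  total_ext fun k m => by
    rw [coeff_sgn, coeff_sgn, smul_smul, ← mul_pow, neg_one_mul, neg_neg, one_pow, one_smul]

theorem DD_sgn (ω : A.Total S) : A.DD S (A.sgn S ω) = A.sgn S (A.DD S ω) :=
  total_ext fun k m => by
    cases k with
    | zero => rw [coeff_DD_zero, coeff_sgn, coeff_DD_zero, smul_zero]
    | succ k => rw [coeff_DD_succ, coeff_sgn, coeff_sgn, coeff_DD_succ, map_smul]

theorem TT_sgn (ω : A.Total S) : A.TT S (A.sgn S ω) = -A.sgn S (A.TT S ω) :=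
  total_ext fun k m => by
    rw [map_neg, coeff_TT, coeff_sgn, coeff_sgn, coeff_TT, map_smul]
    by_cases hm : m < n
    · rw [show n - m = n - (m + 1) + 1 by omega, pow_succ, mul_neg_one]
      module
    · have := A.subsingleton_broken (k := k) (m := m + 1) (by omega)
      rw [Subsingleton.elim (A.coeff S k (m + 1) ω) 0, map_zero, smul_zero, smul_zero,
        neg_zero]

theorem d_apply (ω : A.Total S) : A.d S ω = A.sgn S (A.DD S ω + A.TT S ω) := by
  rw [map_add, ← DD_sgn, ← sub_neg_eq_add, ← TT_sgn]
  rfl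

theorem coeff_d (k m : ℕ) (ω : A.Total S) :
    A.coeff S k m (A.d S ω) =
      (-1 : ℝ) ^ (n - m) • (A.coeff S k m (A.DD S ω) + A.coeff S k m (A.TT S ω)) := by
  rw [d_apply, coeff_sgn, map_add]

theorem d_d (ω : A.Total S) : A.d S (A.d S ω) = 0 := by
  simp only [d_apply, map_add, map_neg, DD_sgn, TT_sgn, sgn_sgn, DD_DD, TT_TT, DD_TT]
  abel

theorem TT_EE_TT {E : A.VertOps} (hE : A.IsVertInverse E) (ω : A.Total S) :
    A.TT S (A.EE S E (A.TT S ω)) = A.TT S ω :=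
  total_ext fun k m => by
    rw [coeff_TT, coeff_EE_succ, coeff_TT]
    exact LinearMap.congr_fun (hE k m) _

theorem DD_PP_DD {P : A.HorizOps} (hP : A.IsHorizInverse P) (ω : A.Total S) :
    A.DD S (A.PP S P (A.DD S ω)) = A.DD S ω :=
  total_ext fun k m => by
    cases k with
    | zero => rw [coeff_DD_zero, coeff_DD_zero]
    | succ k =>
      rw [coeff_DD_succ, coeff_PP, coeff_DD_succ]
      exact LinearMap.congr_fun (hP k m) _

theorem sgn_of_mem {I : Set (ℕ × ℕ)} {m : ℕ} (hI : ∀ q ∈ I, q.2 = m) {ω : A.Total S}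
    (h : ω ∈ A.supported S I) : A.sgn S ω = (-1 : ℝ) ^ (n - m) • ω :=
  total_ext fun k' m' => by
    rw [coeff_sgn, map_smul]
    by_cases hkm : (k', m') ∈ I
    · rw [← hI _ hkm]
    · rw [mem_supported.1 h k' m' hkm, smul_zero, smul_zero]

theorem smul_d_of_mem {I : Set (ℕ × ℕ)} {m : ℕ} (hI : ∀ q ∈ I, q.2 = m) {ω : A.Total S}
    (h : ω ∈ A.supported S I) : (-1 : ℝ) ^ (n - m) • A.d S ω = A.DD S ω - A.TT S ω := by
  rw [← map_smul, ← sgn_of_mem hI h]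
  change A.DD S (A.sgn S (A.sgn S ω)) - A.TT S (A.sgn S (A.sgn S ω)) = _
  rw [sgn_sgn]

theorem exists_TT_eq (hgeom : A.GeometricDecomposition) (hpatch : A.LocalPatch) {k m : ℕ}
    (hm : m < n) {ω : A.Total S} (hω : ω ∈ A.supported S {(k, m)}) (h : A.TT S ω = 0) :
    ∃ η ∈ A.supported S {(k, m + 1)}, A.TT S η = ω := by
  have hker : A.coeff S k m ω ∈ A.vertKer k m := by
    cases m with
    | zero => trivial
    | succ m => exact (coeff_TT k m ω).symm.trans (by rw [h, map_zero])
  obtain ⟨y, hy⟩ := exists_Tv_eq hgeom hpatch hm hker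
  refine ⟨_, ((A.coeffEquiv S k (m + 1)).symm y).2, eq_of_mem_supported_singleton
    (A.TT_mem S ?_ ((A.coeffEquiv S k (m + 1)).symm y).2) hω ?_⟩
  · exact fun k' m' h' => by simpa using h'
  · rw [coeff_TT, coeff_coeffEquiv_symm, hy]

theorem exists_DD_eq (hexact : A.LocalExactness) {k m : ℕ} {ω : A.Total S}
    (hω : ω ∈ A.supported S {(k + 1, m)}) (h : A.DD S ω = 0) :
    ∃ η ∈ A.supported S {(k, m)}, A.DD S η = ω := by
  have hker : A.D (k + 1) m (A.coeff S (k + 1) m ω) = 0 := by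
    rw [← coeff_DD_succ, h, map_zero]
  obtain ⟨y, hy⟩ := exists_D_eq hexact _ hker
  refine ⟨_, ((A.coeffEquiv S k m).symm y).2, eq_of_mem_supported_singleton
    (A.DD_mem S ?_ ((A.coeffEquiv S k m).symm y).2) hω ?_⟩
  · exact fun k' m' h' => by simpa using h'
  · rw [coeff_DD_succ, coeff_coeffEquiv_symm, hy]

end Differentials

variable {A} {S : A.ScalarProducts}

section Filtrations

theorem Lam_one {k : ℤ} {m : ℕ} :
    A.Lam S k m 1 = A.supported S {q | (q.1 : ℤ) = k ∧ q.2 = m} := by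
  simp [Lam]

theorem mem_Lam_zero {k : ℤ} {m : ℕ} {ω : A.Total S} :
    ω ∈ A.Lam S k m 0 ↔ ω ∈ A.Lam S k m 1 ∧ A.TT S ω = 0 := by
  rw [Lam_one]
  rfl

theorem mem_Lam_succ {k : ℤ} {m b : ℕ} {ω : A.Total S} : ω ∈ A.Lam S k m (b + 1) ↔
    ∀ k' m' : ℕ, ¬((k' : ℤ) + m = k + m' ∧ m' ≤ m ∧ m ≤ m' + b) → A.coeff S k' m' ω = 0 := by
  refine mem_supported.trans (forall₂_congr fun k' m' => imp_congr_left (not_congr ⟨?_, ?_⟩))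
  · rintro ⟨j, hj, h1, h2⟩
    dsimp only at h1 h2
    omega
  · intro h
    exact ⟨m - m', by omega, by dsimp only; omega, by dsimp only; omega⟩

theorem Gam_one {k m : ℕ} : A.Gam S k m 1 = A.supported S {q | q.1 = k ∧ q.2 = m} := by
  simp [Gam]

theorem mem_Gam_zero {k m : ℕ} {ω : A.Total S} :
    ω ∈ A.Gam S k m 0 ↔ ω ∈ A.Gam S k m 1 ∧ A.DD S ω = 0 := by
  rw [Gam_one]
  rfl

theorem mem_Gam_succ {k m b : ℕ} {ω : A.Total S} : ω ∈ A.Gam S k m (b + 1) ↔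
    ∀ k' m' : ℕ, ¬(k' + m = k + m' ∧ m ≤ m' ∧ m' ≤ m + b) → A.coeff S k' m' ω = 0 := by
  refine mem_supported.trans (forall₂_congr fun k' m' => imp_congr_left (not_congr ⟨?_, ?_⟩))
  · rintro ⟨j, hj, h1, h2⟩
    dsimp only at h1 h2
    omega
  · intro h
    exact ⟨m' - m, by omega, by dsimp only; omega, by dsimp only; omega⟩

theorem Lam_mono {k : ℤ} {m b : ℕ} : A.Lam S k m b ≤ A.Lam S k m (b + 1) := by
  cases b with
  | zero => exact fun ω hω => (mem_Lam_zero.1 hω).1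
  | succ b =>
    exact fun ω hω => mem_Lam_succ.2 fun k' m' h => mem_Lam_succ.1 hω k' m' (by omega)

theorem Gam_mono {k m b : ℕ} : A.Gam S k m b ≤ A.Gam S k m (b + 1) := by
  cases b with
  | zero => exact fun ω hω => (mem_Gam_zero.1 hω).1
  | succ b =>
    exact fun ω hω => mem_Gam_succ.2 fun k' m' h => mem_Gam_succ.1 hω k' m' (by omega)

theorem coeff_DD_eq_zero {k m : ℕ} {ω : A.Total S}
    (h : ∀ j, j + 1 = k → A.coeff S j m ω = 0) : A.coeff S k m (A.DD S ω) = 0 := by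
  cases k with
  | zero => exact coeff_DD_zero m ω
  | succ k => rw [coeff_DD_succ, h k rfl, map_zero]

theorem coeff_TT_eq_zero {k m : ℕ} {ω : A.Total S} (h : A.coeff S k (m + 1) ω = 0) :
    A.coeff S k m (A.TT S ω) = 0 := by
  rw [coeff_TT, h, map_zero]

theorem d_mem_Lam {k : ℤ} {m b : ℕ} {ω : A.Total S} (hω : ω ∈ A.Lam S (k - 1) m b) :
    A.d S ω ∈ A.Lam S k m (b + 1) := by
  refine mem_Lam_succ.2 fun k' m' h => ?_
  have hDD : A.coeff S k' m' (A.DD S ω) = 0 :=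
    coeff_DD_eq_zero fun j hj => mem_Lam_succ.1 (Lam_mono hω) j m' (by omega)
  have hTT : A.coeff S k' m' (A.TT S ω) = 0 := by
    cases b with
    | zero => rw [(mem_Lam_zero.1 hω).2, map_zero]
    | succ b => exact coeff_TT_eq_zero (mem_Lam_succ.1 hω k' (m' + 1) (by omega))
  rw [coeff_d, hDD, hTT, add_zero, smul_zero]

theorem d_mem_Gam {k m b : ℕ} {ω : A.Total S} (hω : ω ∈ A.Gam S k (m + 1) b) :
    A.d S ω ∈ A.Gam S k m (b + 1) := by
  refine mem_Gam_succ.2 fun k' m' h => ?_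
  have hDD : A.coeff S k' m' (A.DD S ω) = 0 := by
    cases b with
    | zero => rw [(mem_Gam_zero.1 hω).2, map_zero]
    | succ b => exact coeff_DD_eq_zero fun j hj => mem_Gam_succ.1 hω j m' (by omega)
  have hTT : A.coeff S k' m' (A.TT S ω) = 0 :=
    coeff_TT_eq_zero (mem_Gam_succ.1 (Gam_mono hω) k' (m' + 1) (by omega))
  rw [coeff_d, hDD, hTT, add_zero, smul_zero]

end Filtrations

section ExtremeComponents

theorem TT_component_zero (k : ℕ) (ω : A.Total S) : A.TT S (A.component S k 0 ω) = 0 :=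
  total_ext fun k' m' => by
    rw [coeff_TT, coeff_component, if_neg (by omega), map_zero, map_zero]

theorem TT_component_succ (k m : ℕ) (ω : A.Total S) :
    A.TT S (A.component S k (m + 1) ω) = A.component S k m (A.TT S ω) :=
  total_ext fun k' m' => by
    simp only [coeff_TT, coeff_component, Nat.add_right_cancel_iff]
    split_ifs
    · rfl
    · exact map_zero _

theorem DD_component (k m : ℕ) (ω : A.Total S) :
    A.DD S (A.component S k m ω) = A.component S (k + 1) m (A.DD S ω) :=
  total_ext fun k' m' => by
    cases k' with
    | zero => rw [coeff_DD_zero, coeff_component, if_neg (by omega)]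
    | succ k' =>
      simp only [coeff_DD_succ, coeff_component, Nat.add_right_cancel_iff]
      split_ifs
      · rfl
      · exact map_zero _

theorem component_eq_zero {k m : ℕ} {ω : A.Total S} (h : A.coeff S k m ω = 0) :
    A.component S k m ω = 0 :=
  eq_of_mem_supported_singleton (A.component_mem S k m ω) (Submodule.zero_mem _) (by
    rw [coeff_component, if_pos ⟨rfl, rfl⟩, h, map_zero])

theorem coeff_DD_add_coeff_TT {k m : ℕ} {ω : A.Total S} (h : A.coeff S k m (A.d S ω) = 0) :
    A.coeff S k m (A.DD S ω) + A.coeff S k m (A.TT S ω) = 0 :=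
  (isUnit_one.neg.pow (n - m)).smul_eq_zero.1 ((coeff_d k m ω).symm.trans h)

theorem TT_component_eq_zero {k : ℤ} {m b j i : ℕ} (hi : i + b = m) {ω : A.Total S}
    (hω : ω ∈ A.Lam S k m (b + 1)) (hd : ∀ i' < i, A.coeff S j i' (A.d S ω) = 0) :
    A.TT S (A.component S j i ω) = 0 := by
  cases i with
  | zero => exact TT_component_zero j ω
  | succ i =>
    have hDD : A.coeff S j i (A.DD S ω) = 0 :=
      coeff_DD_eq_zero fun j' _ => mem_Lam_succ.1 hω j' i (by omega)
    have hTT := coeff_DD_add_coeff_TT (hd i i.lt_succ_self)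
    rw [hDD, zero_add] at hTT
    rw [TT_component_succ, component_eq_zero hTT]

theorem DD_component_eq_zero {k m b j i : ℕ} (hi : m + b = i) {ω : A.Total S}
    (hω : ω ∈ A.Gam S k m (b + 1)) (hd : A.coeff S (j + 1) i (A.d S ω) = 0) :
    A.DD S (A.component S j i ω) = 0 := by
  have hTT : A.coeff S (j + 1) i (A.TT S ω) = 0 :=
    coeff_TT_eq_zero (mem_Gam_succ.1 hω _ _ (by omega))
  have hDD := coeff_DD_add_coeff_TT hd
  rw [hTT, add_zero] at hDD
  rw [DD_component, component_eq_zero hDD]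

theorem add_smul_d_mem_Lam {k : ℤ} {m b j i : ℕ} (hj : (j : ℤ) + (b + 1) = k)
    (hi : i + (b + 1) = m) {ω η : A.Total S} (hω : ω ∈ A.Lam S k m (b + 2))
    (hη : η ∈ A.supported S {(j, i + 1)}) (h : A.TT S η = A.component S j i ω) :
    ω + (-1 : ℝ) ^ (n - (i + 1)) • A.d S η ∈ A.Lam S k m (b + 1) := by
  rw [smul_d_of_mem (fun q hq => congrArg Prod.snd hq) hη, h]
  refine mem_Lam_succ.2 fun k' m' hkm => ?_
  have hDD : A.coeff S k' m' (A.DD S η) = 0 := by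
    refine coeff_DD_eq_zero fun j' hj' => mem_supported.1 hη j' m' fun hmem => ?_
    obtain ⟨rfl, rfl⟩ := Prod.mk.inj hmem
    omega
  rw [map_add, map_sub, hDD, coeff_component]
  split_ifs with heq
  · rw [zero_sub, add_neg_cancel]
  · rw [mem_Lam_succ.1 hω k' m' (by omega), sub_zero, add_zero]

theorem sub_smul_d_mem_Gam {k m b j i : ℕ} (hj : k + b = j) (hi : m + (b + 1) = i)
    {ω η : A.Total S} (hω : ω ∈ A.Gam S k m (b + 2)) (hη : η ∈ A.supported S {(j, i)})
    (h : A.DD S η = A.component S (j + 1) i ω) :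
    ω - (-1 : ℝ) ^ (n - i) • A.d S η ∈ A.Gam S k m (b + 1) := by
  rw [smul_d_of_mem (fun q hq => congrArg Prod.snd hq) hη, h]
  refine mem_Gam_succ.2 fun k' m' hkm => ?_
  have hTT : A.coeff S k' m' (A.TT S η) = 0 := by
    refine coeff_TT_eq_zero (mem_supported.1 hη _ _ fun hmem => ?_)
    obtain ⟨rfl, hm⟩ := Prod.mk.inj hmem
    omega
  rw [map_sub, map_sub, hTT, sub_zero, coeff_component]
  split_ifs with heq
  · exact sub_self _
  · rw [mem_Gam_succ.1 hω k' m' (by omega), sub_zero]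

theorem map_d_Lam (hgeom : A.GeometricDecomposition) (hpatch : A.LocalPatch) {k b : ℕ}
    (hbk : b < k) (hkn : k ≤ n) :
    (A.Lam S (k - 1) n b).map (A.d S) =
      (A.Lam S (k - 1) n (b + 1)).map (A.d S) ⊓ A.Lam S k n (b + 1) := by
  refine le_antisymm (le_inf (Submodule.map_mono Lam_mono) ?_) ?_
  · exact Submodule.map_le_iff_le_comap.2 fun ω hω => d_mem_Lam hω
  · rintro _ ⟨⟨ω, hω, rfl⟩, hd⟩
    obtain ⟨j, hj⟩ : ∃ j, j + (b + 1) = k := ⟨k - (b + 1), by omega⟩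
    obtain ⟨i, hi⟩ : ∃ i, i + b = n := ⟨n - b, by omega⟩
    have hTT : A.TT S (A.component S j i ω) = 0 :=
      TT_component_eq_zero hi hω fun i' _ => mem_Lam_succ.1 hd j i' (by omega)
    cases b with
    | zero =>
      have hω' : ω ∈ A.supported S {(j, i)} := mem_supported.2 fun k' m' hkm =>
        mem_Lam_succ.1 hω k' m' fun h =>
          hkm (Prod.ext (by dsimp only; omega) (by dsimp only; omega))
      rw [component_of_mem hω'] at hTT
      exact ⟨ω, mem_Lam_zero.2 ⟨hω, hTT⟩, rfl⟩
    | succ b =>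
      obtain ⟨η, hη, hTη⟩ := exists_TT_eq hgeom hpatch (by omega) (A.component_mem S j i ω) hTT
      refine ⟨_, add_smul_d_mem_Lam (by omega) hi hω hη hTη, ?_⟩
      rw [map_add, map_smul, d_d, smul_zero, add_zero]

theorem map_d_Gam (hexact : A.LocalExactness) (k m b : ℕ) :
    (A.Gam S k (m + 1) b).map (A.d S) =
      (A.Gam S k (m + 1) (b + 1)).map (A.d S) ⊓ A.Gam S k m (b + 1) := by
  refine le_antisymm (le_inf (Submodule.map_mono Gam_mono) ?_) ?_
  · exact Submodule.map_le_iff_le_comap.2 fun ω hω => d_mem_Gam hω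
  · rintro _ ⟨⟨ω, hω, rfl⟩, hd⟩
    have hDD : A.DD S (A.component S (k + b) (m + 1 + b) ω) = 0 :=
      DD_component_eq_zero rfl hω (mem_Gam_succ.1 hd _ _ (by omega))
    cases b with
    | zero =>
      have hω' : ω ∈ A.supported S {(k + 0, m + 1 + 0)} := mem_supported.2 fun k' m' hkm =>
        mem_Gam_succ.1 hω k' m' fun h =>
          hkm (Prod.ext (by dsimp only; omega) (by dsimp only; omega))
      rw [component_of_mem hω'] at hDD
      exact ⟨ω, mem_Gam_zero.2 ⟨hω, hDD⟩, rfl⟩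
    | succ b =>
      obtain ⟨η, hη, hDη⟩ := exists_DD_eq hexact (A.component_mem S (k + b + 1) _ ω) hDD
      refine ⟨_, sub_smul_d_mem_Gam rfl rfl hω hη hDη, ?_⟩
      rw [map_sub, map_smul, d_d, smul_zero, sub_zero]

end ExtremeComponents

section Regularizers

theorem TT_EE_eq (hgeom : A.GeometricDecomposition) (hpatch : A.LocalPatch) {E : A.VertOps}
    (hE : A.IsVertInverse E) {k m : ℕ} (hm : m < n) {ω : A.Total S}
    (hω : ω ∈ A.supported S {(k, m)}) (h : A.TT S ω = 0) : A.TT S (A.EE S E ω) = ω := by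
  obtain ⟨η, -, rfl⟩ := exists_TT_eq hgeom hpatch hm hω h
  exact TT_EE_TT hE η

theorem DD_PP_eq (hexact : A.LocalExactness) {P : A.HorizOps} (hP : A.IsHorizInverse P)
    {k m : ℕ} {ω : A.Total S} (hω : ω ∈ A.supported S {(k + 1, m)}) (h : A.DD S ω = 0) :
    A.DD S (A.PP S P ω) = ω := by
  obtain ⟨η, -, rfl⟩ := exists_DD_eq hexact hω h
  exact DD_PP_DD hP η

theorem EE_component_mem (E : A.VertOps) (k m : ℕ) (ω : A.Total S) :
    A.EE S E (A.component S k m ω) ∈ A.supported S {(k, m + 1)} :=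
  A.EE_mem S E (by rintro _ _ ⟨⟩; rfl) (A.component_mem S k m ω)

theorem PP_component_mem (P : A.HorizOps) (k m : ℕ) (ω : A.Total S) :
    A.PP S P (A.component S (k + 1) m ω) ∈ A.supported S {(k, m)} :=
  A.PP_mem S P (by rintro _ _ ⟨⟩; rfl) (A.component_mem S (k + 1) m ω)

theorem preR_apply (E : A.VertOps) {k b j i : ℕ} (hj : j + (b + 1) = k) (hi : i + (b + 1) = n)
    (ω : A.Total S) : A.preR S E k (b + 2) ω =
      ω + (-1 : ℝ) ^ (n - (i + 1)) • A.d S (A.EE S E (A.component S j i ω)) := by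
  have hk : k + 1 - (b + 2) = j := by omega
  have hn : n + 1 - (b + 2) = i := by omega
  have hb : n - (i + 1) = b := by omega
  rw [preR, hk, hn, hb, pow_add _ b 3]
  simp only [LinearMap.sub_apply, LinearMap.smul_apply, LinearMap.comp_apply, LinearMap.id_apply]
  module

theorem preS_apply (P : A.HorizOps) {m b : ℕ} (hm : m + (b + 1) ≤ n) (ω : A.Total S) :
    A.preS S P m (b + 2) ω = ω - (-1 : ℝ) ^ (n - (m + (b + 1))) •
      A.d S (A.PP S P (A.component S (b + 1) (m + (b + 1)) ω)) := by
  have hn : b + 2 + (n - m) = n - (m + (b + 1)) + (2 * b + 3) := by omega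
  have hodd : (-1 : ℝ) ^ (2 * b + 3) = -1 := Odd.neg_one_pow ⟨b + 1, by omega⟩
  rw [preS, hn, pow_add, hodd, mul_neg_one, sub_eq_add_neg, ← neg_smul]
  rfl

theorem preR_mem_Lam (hgeom : A.GeometricDecomposition) (hpatch : A.LocalPatch) {E : A.VertOps}
    (hE : A.IsVertInverse E) {k b : ℕ} (hb : b + 1 ≤ k) (hk : k ≤ n) {ω : A.Total S}
    (hω : ω ∈ A.Lam S k n (b + 2)) (hd : A.d S ω = 0) :
    A.preR S E k (b + 2) ω ∈ A.Lam S k n (b + 1) := by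
  obtain ⟨j, hj⟩ : ∃ j, j + (b + 1) = k := ⟨k - (b + 1), by omega⟩
  obtain ⟨i, hi⟩ : ∃ i, i + (b + 1) = n := ⟨n - (b + 1), by omega⟩
  have hTT : A.TT S (A.component S j i ω) = 0 :=
    TT_component_eq_zero hi hω fun i' _ => by rw [hd, map_zero]
  rw [preR_apply E hj hi]
  exact add_smul_d_mem_Lam (by omega) hi hω (EE_component_mem E j i ω)
    (TT_EE_eq hgeom hpatch hE (by omega) (A.component_mem S j i ω) hTT)

theorem preS_mem_Gam (hexact : A.LocalExactness) {P : A.HorizOps} (hP : A.IsHorizInverse P)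
    {m b : ℕ} (hm : m + (b + 1) ≤ n) {ω : A.Total S} (hω : ω ∈ A.Gam S 0 m (b + 2))
    (hd : A.d S ω = 0) : A.preS S P m (b + 2) ω ∈ A.Gam S 0 m (b + 1) := by
  have hDD : A.DD S (A.component S (b + 1) (m + (b + 1)) ω) = 0 :=
    DD_component_eq_zero rfl hω (by rw [hd, map_zero])
  rw [preS_apply P hm]
  exact sub_smul_d_mem_Gam (zero_add b) rfl hω (PP_component_mem P b _ ω)
    (DD_PP_eq hexact hP (A.component_mem S _ _ ω) hDD)

theorem sub_preR_mem (E : A.VertOps) {k b : ℕ} (hb : b + 1 ≤ k) (hk : k ≤ n) (ω : A.Total S) :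
    ω - A.preR S E k (b + 2) ω ∈ (A.Lam S (k - 1) n (b + 1)).map (A.d S) := by
  obtain ⟨j, hj⟩ : ∃ j, j + (b + 1) = k := ⟨k - (b + 1), by omega⟩
  obtain ⟨i, hi⟩ : ∃ i, i + (b + 1) = n := ⟨n - (b + 1), by omega⟩
  have hEE : A.EE S E (A.component S j i ω) ∈ A.Lam S (k - 1) n (b + 1) :=
    mem_Lam_succ.2 fun k' m' h => mem_supported.1 (EE_component_mem E j i ω) k' m'
      (by rintro ⟨⟩; omega)
  rw [preR_apply E hj hi, sub_add_cancel_left]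
  exact Submodule.neg_mem _ (Submodule.smul_mem _ _ (Submodule.mem_map_of_mem hEE))

theorem sub_preS_mem (P : A.HorizOps) {m b : ℕ} (hm : m + (b + 1) ≤ n) (ω : A.Total S) :
    ω - A.preS S P m (b + 2) ω ∈ (A.Gam S 0 (m + 1) (b + 1)).map (A.d S) := by
  have hPP : A.PP S P (A.component S (b + 1) (m + (b + 1)) ω) ∈ A.Gam S 0 (m + 1) (b + 1) :=
    mem_Gam_succ.2 fun k' m' h => mem_supported.1 (PP_component_mem P b _ ω) k' m'
      (by rintro ⟨⟩; omega)
  rw [preS_apply P hm, sub_sub_cancel]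
  exact Submodule.smul_mem _ _ (Submodule.mem_map_of_mem hPP)

theorem preR_eq_self (E : A.VertOps) {k b : ℕ} (hb : b + 1 ≤ k) (hk : k ≤ n) {ω : A.Total S}
    (hω : ω ∈ A.Lam S k n (b + 1)) : A.preR S E k (b + 2) ω = ω := by
  obtain ⟨j, hj⟩ : ∃ j, j + (b + 1) = k := ⟨k - (b + 1), by omega⟩
  obtain ⟨i, hi⟩ : ∃ i, i + (b + 1) = n := ⟨n - (b + 1), by omega⟩
  have h0 : A.component S j i ω = 0 := component_eq_zero (mem_Lam_succ.1 hω j i (by omega))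
  rw [preR_apply E hj hi, h0, map_zero, map_zero, smul_zero, add_zero]

theorem preS_eq_self (P : A.HorizOps) {m b : ℕ} (hm : m + (b + 1) ≤ n) {ω : A.Total S}
    (hω : ω ∈ A.Gam S 0 m (b + 1)) : A.preS S P m (b + 2) ω = ω := by
  have h0 : A.component S (b + 1) (m + (b + 1)) ω = 0 :=
    component_eq_zero (mem_Gam_succ.1 hω _ _ (by omega))
  rw [preS_apply P hm, h0, map_zero, map_zero, smul_zero, sub_zero]

theorem exists_distHarm_equiv (hgeom : A.GeometricDecomposition) (hpatch : A.LocalPatch)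
    {E : A.VertOps} (hE : A.IsVertInverse E) {k b : ℕ} (hb : 2 ≤ b) (hbk : b ≤ k + 1)
    (hk : k ≤ n) :
    ∃ e : A.distHarm S k n (b - 1) ≃ₗ[ℝ] A.distHarm S k n b,
      ∀ h : A.distHarm S k n (b - 1), ∃ hh : (h : A.Total S) ∈ A.Lam S k n b,
        (e h : A.Total S) = A.QR S E hb hbk hk ⟨h, hh⟩ := by
  obtain ⟨b, rfl⟩ : ∃ c, b = c + 2 := ⟨b - 2, by omega⟩
  have hb' : b + 1 ≤ k := by omega
  exact exists_equiv_starProjection_adjoint (A.d S) (A.R S E hb hbk hk) Lam_mono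
    (Submodule.map_le_iff_le_comap.2 fun ω hω => ⟨d_mem_Lam hω, d_d ω⟩)
    (map_d_Lam hgeom hpatch hb' hk)
    (fun z hz => preR_mem_Lam hgeom hpatch hE hb' hk z.2 hz)
    (fun ⟨z, _⟩ _ => sub_preR_mem E hb' hk z)
    (fun z hz => Subtype.ext (preR_eq_self E hb' hk hz))

theorem exists_distVharm_equiv (hexact : A.LocalExactness) {P : A.HorizOps}
    (hP : A.IsHorizInverse P) {m b : ℕ} (hb : 2 ≤ b) (hbm : m + b ≤ n + 1) :
    ∃ e : A.distVharm S 0 m (b - 1) ≃ₗ[ℝ] A.distVharm S 0 m b,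
      ∀ h : A.distVharm S 0 m (b - 1), ∃ hh : (h : A.Total S) ∈ A.Gam S 0 m b,
        (e h : A.Total S) = A.QS S P m hb ⟨h, hh⟩ := by
  obtain ⟨b, rfl⟩ : ∃ c, b = c + 2 := ⟨b - 2, by omega⟩
  have hbm' : m + (b + 1) ≤ n := by omega
  exact exists_equiv_starProjection_adjoint (A.d S) (A.regS S P m hb) Gam_mono
    (Submodule.map_le_iff_le_comap.2 fun ω hω => ⟨d_mem_Gam hω, d_d ω⟩)
    (map_d_Gam hexact 0 m b)
    (fun z hz => preS_mem_Gam hexact hP hbm' z.2 hz)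
    (fun ⟨z, _⟩ _ => sub_preS_mem P hbm' z)
    (fun z hz => Subtype.ext (preS_eq_self P hbm' hz))

end Regularizers

section Ends

theorem d_eq_zero_iff {I : Set (ℕ × ℕ)} {m : ℕ} (hI : ∀ q ∈ I, q.2 = m) {ω : A.Total S}
    (h : ω ∈ A.supported S I) : A.d S ω = 0 ↔ A.DD S ω = 0 ∧ A.TT S ω = 0 := by
  refine ⟨fun hd => ?_, fun ⟨hDD, hTT⟩ => by rw [d_apply, hDD, hTT, add_zero, map_zero]⟩
  have heq : A.DD S ω = A.TT S ω := by
    rw [← sub_eq_zero, ← smul_d_of_mem hI h, hd, smul_zero]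
  suffices hDD : A.DD S ω = 0 from ⟨hDD, heq ▸ hDD⟩
  -- `D ω` and `T ω` live on simplices of different dimensions.
  have hω : ∀ k' m', m' ≠ m → A.coeff S k' m' ω = 0 := fun k' m' hm' =>
    mem_supported.1 h k' m' fun hmem => hm' (hI _ hmem)
  refine total_ext fun k' m' => ?_
  rw [map_zero]
  by_cases hm' : m' = m
  · rw [heq]
    exact coeff_TT_eq_zero (hω k' (m' + 1) (by omega))
  · exact coeff_DD_eq_zero fun j _ => hω j m' hm'

theorem vharm_eq_distVharm (k m : ℕ) : A.vharm S k m = A.distVharm S k m 1 := by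
  have hcycles : A.Gam S k m 0 ⊓ LinearMap.ker (A.TT S) =
      A.Gam S k m 1 ⊓ LinearMap.ker (A.d S) := by
    rw [Gam_one]
    ext ω
    exact and_assoc.trans (and_congr_right fun hω => (d_eq_zero_iff (fun _ hq => hq.2) hω).symm)
  have hbdries : (A.Gam S k (m + 1) 0).map (A.TT S) = (A.Gam S k (m + 1) 0).map (A.d S) := by
    rw [← Submodule.map_smul (A.d S) _ (-(-1 : ℝ) ^ (n - (m + 1)))
      (neg_ne_zero.2 (pow_ne_zero _ (by norm_num)))]
    refine SetLike.coe_injective (Set.image_congr fun ω hω => ?_)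
    rw [LinearMap.smul_apply, neg_smul, smul_d_of_mem (fun _ hq => hq.2) hω.1,
      LinearMap.mem_ker.1 hω.2, zero_sub, neg_neg]
  rw [vharm, distVharm, hcycles, hbdries]

theorem distHarm_eq_harm (k : ℤ) (m : ℕ) : A.distHarm S k m 1 = A.harm S k m := by
  have hcycles : A.Lam S k m 1 ⊓ LinearMap.ker (A.d S) =
      A.Lam S k m 0 ⊓ LinearMap.ker (A.DD S) := by
    rw [Lam_one]
    ext ω
    exact (and_congr_right fun hω => (d_eq_zero_iff (fun _ hq => hq.2) hω).trans
      and_comm).trans and_assoc.symm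
  have hbdries : (A.Lam S (k - 1) m 0).map (A.d S) = (A.Lam S (k - 1) m 0).map (A.DD S) := by
    rw [← Submodule.map_smul (A.d S) _ ((-1 : ℝ) ^ (n - m)) (pow_ne_zero _ (by norm_num))]
    refine SetLike.coe_injective (Set.image_congr fun ω hω => ?_)
    rw [LinearMap.smul_apply, smul_d_of_mem (fun _ hq => hq.2) hω.1, LinearMap.mem_ker.1 hω.2,
      sub_zero]
  rw [harm, distHarm, hcycles, hbdries]

theorem Gam_eq_bot {k m b : ℕ} (hm : n < m) : A.Gam S k m b = ⊥ := by
  refine (Submodule.eq_bot_iff _).2 fun ω hω => total_ext fun k' m' => ?_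
  by_cases hm' : m' ≤ n
  · rw [mem_Gam_succ.1 (Gam_mono hω) k' m' (by omega), map_zero]
  · have := A.subsingleton_broken (k := k') (m := m') (by omega)
    exact Subsingleton.elim _ _

theorem Lam_eq_bot {k : ℤ} {m b : ℕ} (hk : k < 0) : A.Lam S k m b = ⊥ :=
  (Submodule.eq_bot_iff _).2 fun ω hω => total_ext fun k' m' => by
    rw [mem_Lam_succ.1 (Lam_mono hω) k' m' (by omega), map_zero]

theorem Gam_eq_Lam {k : ℕ} (hk : k ≤ n) : A.Gam S 0 (n - k) (k + 1) = A.Lam S k n (k + 1) :=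
  Submodule.ext fun ω => by
    rw [mem_Gam_succ, mem_Lam_succ]
    exact forall₂_congr fun k' m' => imp_congr_left (by omega)

theorem distVharm_eq_distHarm {k : ℕ} (hk : k ≤ n) :
    A.distVharm S 0 (n - k) (k + 1) = A.distHarm S k n (k + 1) := by
  have h : A.Gam S 0 (n - k + 1) k = A.Lam S (k - 1) n k := by
    cases k with
    | zero => rw [Gam_eq_bot (by omega), Lam_eq_bot (by omega)]
    | succ k =>
      rw [show n - (k + 1) + 1 = n - k by omega, Gam_eq_Lam (by omega), Nat.cast_succ,
        add_sub_cancel_right]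
  rw [distVharm, distHarm, Gam_eq_Lam hk, Nat.add_sub_cancel, h]

end Ends

section Homology

theorem mem_Gam_zero_iff_coeff {k m : ℕ} {ω : A.Total S} :
    ω ∈ A.Gam S k m 0 ↔ ω ∈ A.supported S {(k, m)} ∧ A.D k m (A.coeff S k m ω) = 0 := by
  have hsupp : A.Gam S k m 1 = A.supported S {(k, m)} := by
    rw [Gam_one]
    congr 1
    ext q
    simp [Prod.ext_iff]
  rw [mem_Gam_zero, hsupp, ← coeff_DD_succ]
  refine and_congr_right fun hω => ⟨fun h => by rw [h, map_zero], fun h => ?_⟩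
  refine eq_of_mem_supported_singleton (A.DD_mem S (fun k' m' h => ?_) hω) (zero_mem _)
    (h.trans (map_zero _).symm)
  simpa using h

variable (S) (hexact : A.LocalExactness)

/-- The piecewise constant form `∑ c_C 1_C` of a relative simplicial chain `∑ c_C C`. -/
def chainBroken (m : ℕ) : A.Chain A.T.faces A.U.faces m →ₗ[ℝ] A.Broken 0 m where
  toFun c C := c C • A.indicatorForm hexact C
  map_add' _ _ := funext fun _ => add_smul _ _ _
  map_smul' _ _ := funext fun _ => mul_smul _ _ _

theorem chainBroken_injective (m : ℕ) : Function.Injective (chainBroken hexact m) := by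
  intro c c' h
  funext C
  have hne : A.indicatorForm hexact C ≠ 0 := fun h0 => indicator_ne_zero
    (Finset.card_pos.1 (by rw [C.1.2.2]; omega)) (congrArg Subtype.val h0)
  exact smul_left_injective ℝ hne (congrFun h C)

theorem range_chainBroken (m : ℕ) :
    LinearMap.range (chainBroken hexact m) = LinearMap.ker (A.D 0 m) := by
  refine le_antisymm ?_ fun x hx => ?_
  · rintro _ ⟨c, rfl⟩
    funext C
    have h : A.dd 0 C.1.2.1 (A.indicatorForm hexact C) = 0 :=
      Subtype.ext ((hexact C.1.1 C.2.1 C.2.2).1.ge (Submodule.mem_span_singleton_self _)).2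
    exact ((A.dd 0 C.1.2.1).map_smul (c C) _).trans (by rw [h, smul_zero]; rfl)
  · have h (C : A.Cell m) : ∃ r : ℝ, r • indicator C.1.1 = (x C : SmoothForm 0 C.1.1) :=
      Submodule.mem_span_singleton.1 ((hexact C.1.1 C.2.1 C.2.2).1.le
        ⟨(x C).2, congrArg Subtype.val (congrFun hx C)⟩)
    choose c hc using h
    exact ⟨c, funext fun C => Subtype.ext (hc C)⟩

theorem Tv_chainBroken {m : ℕ} (c : A.Chain A.T.faces A.U.faces (m + 1)) :
    A.Tv 0 m (chainBroken hexact (m + 1) c) =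
      chainBroken hexact m (A.bdry A.T.faces A.U.faces m c) := by
  refine funext fun F => Subtype.ext ((coe_Tv _ F (g := fun C => c C • indicator F.1.1)
    fun C h => (trace 0 h).map_smul (c C) (indicator C.1.1)).trans ?_)
  change ∑ C, A.incidence F.1 C.1 • c C • indicator F.1.1 =
    (∑ C, A.incidence F.1 C.1 * c C) • indicator F.1.1
  simp only [Finset.sum_smul, mul_smul]

/-- The chain `∑ c_C C` as the element `∑ c_C 1_C` of the direct sum: `chainForm` as a linear map,
without the bound `m ≤ n` on the dimension. -/
def chainMap (m : ℕ) : A.Chain A.T.faces A.U.faces m →ₗ[ℝ] A.Total S :=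
  Submodule.subtype _ ∘ₗ (A.coeffEquiv S 0 m).symm.toLinearMap ∘ₗ chainBroken hexact m

theorem chainMap_mem {m : ℕ} (c : A.Chain A.T.faces A.U.faces m) :
    chainMap S hexact m c ∈ A.supported S {(0, m)} :=
  ((A.coeffEquiv S 0 m).symm _).2

theorem coeff_chainMap {m : ℕ} (c : A.Chain A.T.faces A.U.faces m) :
    A.coeff S 0 m (chainMap S hexact m c) = chainBroken hexact m c :=
  coeff_coeffEquiv_symm _

theorem chainMap_injective (m : ℕ) : Function.Injective (chainMap S hexact m) :=
  Subtype.val_injective.comp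
    ((A.coeffEquiv S 0 m).symm.injective.comp (chainBroken_injective hexact m))

theorem chainForm_eq_chainMap {m : ℕ} (hm : m ≤ n) (c : A.Chain A.T.faces A.U.faces m) :
    A.chainForm S hexact hm c = chainMap S hexact m c := by
  let p : Fin (n + 1) × Fin (n + 1) := (⟨0, n.succ_pos⟩, ⟨m, Nat.lt_succ_of_le hm⟩)
  let M := fun p : Fin (n + 1) × Fin (n + 1) => A.HBroken S p.1 p.2
  refine eq_of_mem_supported_singleton (fun q hq => ?_) (chainMap_mem S hexact c) ?_
  · exact Pi.single_eq_of_ne (M := M) (fun hqp : q = p => hq (by rw [hqp]; rfl)) _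
  · rw [coeff_chainMap]
    exact (coeff_apply _ p).trans (congrArg (A.toH S 0 m).symm (Pi.single_eq_same (M := M) p _))

theorem range_chainMap (m : ℕ) : LinearMap.range (chainMap S hexact m) = A.Gam S 0 m 0 := by
  ext ω
  rw [mem_Gam_zero_iff_coeff, ← LinearMap.mem_ker, ← range_chainBroken hexact]
  constructor
  · rintro ⟨c, rfl⟩
    exact ⟨chainMap_mem S hexact c, c, (coeff_chainMap S hexact c).symm⟩
  · rintro ⟨hω, c, hc⟩
    exact ⟨c, eq_of_mem_supported_singleton (chainMap_mem S hexact c) hω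
      ((coeff_chainMap S hexact c).trans hc)⟩

theorem TT_chainMap {m : ℕ} (c : A.Chain A.T.faces A.U.faces (m + 1)) :
    A.TT S (chainMap S hexact (m + 1) c) =
      chainMap S hexact m (A.bdry A.T.faces A.U.faces m c) := by
  refine eq_of_mem_supported_singleton (A.TT_mem S ?_ (chainMap_mem S hexact c))
    (chainMap_mem S hexact _) ?_
  · exact fun k' m' h => by simpa using h
  · rw [coeff_TT, coeff_chainMap, Tv_chainBroken, coeff_chainMap]

theorem TT_chainMap_eq_zero_iff {m : ℕ} (c : A.Chain A.T.faces A.U.faces m) :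
    A.TT S (chainMap S hexact m c) = 0 ↔ c ∈ A.cycles A.T.faces A.U.faces m := by
  cases m with
  | zero =>
    refine iff_of_true ?_ trivial
    rw [← component_of_mem (chainMap_mem S hexact c), TT_component_zero]
  | succ m =>
    rw [TT_chainMap]
    exact map_eq_zero_iff _ (chainMap_injective S hexact m)

theorem map_TT_Gam (m : ℕ) : (A.Gam S 0 (m + 1) 0).map (A.TT S) =
    (LinearMap.range (A.bdry A.T.faces A.U.faces m)).map (chainMap S hexact m) := by
  have hcomm : A.TT S ∘ₗ chainMap S hexact (m + 1) =
      chainMap S hexact m ∘ₗ A.bdry A.T.faces A.U.faces m :=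
    LinearMap.ext (TT_chainMap S hexact)
  rw [← range_chainMap S hexact, ← LinearMap.range_comp, ← LinearMap.range_comp, hcomm]

theorem exists_homology_equiv {m : ℕ} (hm : m ≤ n) :
    ∃ Φ : A.Homology A.T.faces A.U.faces m ≃ₗ[ℝ] A.vharm S 0 m,
      ∀ ω : A.vharm S 0 m, ∃ c : A.cycles A.T.faces A.U.faces m,
        A.chainForm S hexact hm c = ω ∧ Φ (Submodule.Quotient.mk c) = ω := by
  let Z := A.cycles A.T.faces A.U.faces m
  let B := (A.Gam S 0 (m + 1) 0).map (A.TT S)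
  let J : Z →ₗ[ℝ] A.Total S := chainMap S hexact m ∘ₗ Z.subtype
  have hZ : Z = (LinearMap.ker (A.TT S)).comap (chainMap S hexact m) :=
    Submodule.ext fun c => (TT_chainMap_eq_zero_iff S hexact c).symm
  have hJ : LinearMap.range J = A.Gam S 0 m 0 ⊓ LinearMap.ker (A.TT S) := by
    rw [LinearMap.range_comp, Submodule.range_subtype, hZ, Submodule.map_comap_eq,
      range_chainMap]
  have hB_eq : B = (LinearMap.range (A.bdry A.T.faces A.U.faces m)).map (chainMap S hexact m) :=
    map_TT_Gam S hexact m
  have hB : (LinearMap.range (A.bdry A.T.faces A.U.faces m)).submoduleOf Z = B.comap J := by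
    rw [Submodule.comap_comp, hB_eq,
      Submodule.comap_map_eq_of_injective (chainMap_injective S hexact m)]
    rfl
  have hBJ : B ≤ LinearMap.range J := by
    rw [hJ, ← range_chainMap S hexact]
    refine le_inf ?_ (Submodule.map_le_iff_le_comap.2 fun ω _ => TT_TT ω)
    exact hB_eq.trans_le LinearMap.map_le_range
  obtain ⟨e, he⟩ := exists_quotient_comap_equiv_inf_orthogonal J hBJ
  refine ⟨(Submodule.quotEquivOfEq _ _ hB).trans
    (e.trans (LinearEquiv.ofEq _ _ (by rw [hJ]; rfl))), fun ω => ?_⟩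
  have hω : (ω : A.Total S) ∈ LinearMap.range J := hJ ▸ ω.2.1
  obtain ⟨c, hc⟩ := hω
  refine ⟨c, (chainForm_eq_chainMap S hexact hm c).trans hc, Subtype.ext ?_⟩
  exact (he c (hc ▸ ω.2.2)).trans hc

end Homology

end FEComplex

end FEDist

theorem theorem5p11 {n : ℕ} (A : FEDist.FEComplex n) (S : A.ScalarProducts)
    (hexact : A.LocalExactness) (hgeom : A.GeometricDecomposition) (hpatch : A.LocalPatch)
    (E : A.VertOps) (hE : A.IsVertInverse E) (P : A.HorizOps) (hP : A.IsHorizInverse P)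
    (k : ℕ) (hk : k ≤ n) :
    (∃ Φ : A.Homology A.T.faces A.U.faces (n - k) ≃ₗ[ℝ] A.vharm S 0 (n - k),
      ∀ ω : A.vharm S 0 (n - k), ∃ c : A.cycles A.T.faces A.U.faces (n - k),
        A.chainForm S hexact (Nat.sub_le n k) c = ω ∧ Φ (Submodule.Quotient.mk c) = ω) ∧
    A.vharm S 0 (n - k) = A.distVharm S 0 (n - k) 1 ∧
    (∀ (b : ℕ) (hb : 2 ≤ b), b ≤ k + 1 →
      ∃ e : A.distVharm S 0 (n - k) (b - 1) ≃ₗ[ℝ] A.distVharm S 0 (n - k) b,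
        ∀ h : A.distVharm S 0 (n - k) (b - 1),
          ∃ hh : (h : A.Total S) ∈ A.Gam S 0 (n - k) b,
            (e h : A.Total S) = A.QS S P (n - k) hb ⟨h, hh⟩) ∧
    A.distVharm S 0 (n - k) (k + 1) = A.distHarm S k n (k + 1) ∧
    (∀ (b : ℕ) (hb : 2 ≤ b) (hbk : b ≤ k + 1),
      ∃ e : A.distHarm S k n (b - 1) ≃ₗ[ℝ] A.distHarm S k n b,
        ∀ h : A.distHarm S k n (b - 1),
          ∃ hh : (h : A.Total S) ∈ A.Lam S k n b,
            (e h : A.Total S) = A.QR S E hb hbk hk ⟨h, hh⟩) ∧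
    A.distHarm S k n 1 = A.harm S k n :=
  ⟨FEDist.FEComplex.exists_homology_equiv S hexact (Nat.sub_le n k),
    FEDist.FEComplex.vharm_eq_distVharm 0 (n - k),
    fun _ hb hbk => FEDist.FEComplex.exists_distVharm_equiv hexact hP hb (by omega),
    FEDist.FEComplex.distVharm_eq_distHarm hk,
    fun _ hb hbk => FEDist.FEComplex.exists_distHarm_equiv hgeom hpatch hE hb hbk hk,
    FEDist.FEComplex.distHarm_eq_harm k n⟩
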